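/- Let $v_2<v_1$ be real with either $v_2<0<v_1$ or $0<v_2<v_1$, and let $\lambda,\xi,t>0$, $0\le q\le 1$. A geometric counting process (GCP) with intensity $\lambda$ is a Poisson process whose rate is random, exponentially distributed with mean $\lambda$. A particle starts at $0$ with velocity $V(0)$, where $P(V(0)=v_1)=q$ and $P(V(0)=v_2)=1-q$, and moves on the line with velocities alternating between $v_1$ and $v_2$; the durations of the successive intervals with velocity $v_1$, respectively $v_2$, are the intertimes of two independent GCPs with intensity $\lambda$. Let $X(t)$ be its position at time $t$. Let $\tilde X(t)$ be the position at time $t$ when, in addition, the particle is reset instantaneously to $0$ at the epochs of an independent Poisson process with rate $\xi$, the motion starting afresh after each reset with velocity $V(0)$. Let $\tilde p(x,t)=P(\tilde X(t)\in dx)/dx$ be the density of $\tilde X(t)$ away from its atoms, taken pointwise as $\lim_{h\downarrow0}P(|\tilde X(t)-x|<h)/(2h)$; likewise $p(x,t)$ for $X(t)$. Put $\Gamma(0,z_0,z_1)=\int_{z_0}^{z_1}u^{-1}e^{-u}\,du$ for $0\le z_0\le z_1$ (with values in $[0,\infty]$), $I(x,t)=\mathbf 1\{\min(v_2t,0)<x<v_1t\}$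 and $$\Gamma^{\xi}(x,t)=\begin{cases}\Gamma\big(0,\ \xi\max\{x/v_1,x/v_2\},\ \xi t\big), & v_2<0<v_1,\\ \Gamma\big(0,\ \xi x/v_1,\ \xi\min\{x/v_2,t\}\big), & 0<v_2<v_1.\end{cases}$$ (a) For every $x$ with $\min(v_2t,0)<x<v_1t$ and $x\ne v_2t$ the density $\tilde p(x,t)$ exists for every $\lambda>0$, and $$\lim_{\lambda\to\infty}\tilde p(x,t)=\pi_\xi(x,t):=\mathbf 1\{v_2t<x<v_1t\}\frac{e^{-\xi t}}{(v_1-v_2)t}+\frac{\xi}{v_1-v_2}\,I(x,t)\,\Gamma^{\xi}(x,t).$$ (If $v_2<0<v_1$ and $x=0$, both sides are $+\infty$.) (b) The limit is not uniform: $\pi_\xi(\cdot,t)$ is not almost everywhere equal to a constant on $(v_2t,v_1t)$. (c) Without resets the limit is uniform: for $v_2t<x<v_1t$ the density $p(x,t)$ exists for every $\lambda>0$ and $\lim_{\lambda\to\infty}p(x,t)=\frac{1}{(v_1-v_2)t}$. Moreover, for every $x\neq 0,\,v_2t$ with $\min(v_2t,0)<x<v_1t$, $\lim_{\xi\downarrow0}\pi_\xi(x,t)=\mathbf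 1\{v_2t<x<v_1t\}\frac{1}{(v_1-v_2)t}$. -/

import Mathlib

open MeasureTheory ProbabilityTheory Filter Set Topology
open scoped ENNReal

noncomputable section

namespace GCPTelegraph

/-! ### Sample paths -/

/-- For a sequence of epochs `S 0 = 0 ≤ S 1 ≤ S 2 ≤ …`, the number of epochs `S 1, S 2, …`
falling in `[0, t]`. -/
def countEpochs (S : ℕ → ℝ) (t : ℝ) : ℕ := {n : ℕ | S (n + 1) ≤ t}.ncard

/-- The two velocities; `true` stands for `v₁` and `false` for `v₂`. -/
def velocityOf (v₁ v₂ : ℝ) (b : Bool) : ℝ := if b then v₁ else v₂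

/-- The velocity index during the `k`-th interval (`k = 0, 1, …`) between velocity changes, when
the motion starts with velocity index `j`: the velocities alternate. -/
def phase (j : Bool) (k : ℕ) : Bool := if Even k then j else !j

/-- The time of the `n`-th velocity change, when `D b i` is the duration of the `i`-th interval
(`i = 0, 1, …`) that is run with velocity index `b`, and `j` is the initial velocity index. The
`k`-th interval of the motion is the `(k / 2)`-th one with its own velocity. -/
def changeEpoch (j : Bool) (D : Bool → ℕ → ℝ) (n : ℕ) : ℝ :=
  ∑ k ∈ Finset.range n, D (phase j k) (k / 2)

/-- The velocity `V(s)` without resets, `N(s) = countEpochs (changeEpoch j D) s` being the number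
of velocity changes up to time `s`. -/
def velocity (v₁ v₂ : ℝ) (j : Bool) (D : Bool → ℕ → ℝ) (s : ℝ) : ℝ :=
  velocityOf v₁ v₂ (phase j (countEpochs (changeEpoch j D) s))

/-- The position `X(t) = ∫₀ᵗ V(s) ds` without resets. -/
def position (v₁ v₂ : ℝ) (j : Bool) (D : Bool → ℕ → ℝ) (t : ℝ) : ℝ :=
  ∫ s in (0 : ℝ)..t, velocity v₁ v₂ j D s

/-- The time of the `m`-th reset, when `R i` is the time between resets `i` and `i + 1` (time `0`
counts as reset `0`). -/
def resetEpoch (R : ℕ → ℝ) (m : ℕ) : ℝ := ∑ i ∈ Finset.range m, R i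

/-- The randomness of the model: the index of the initial velocity `V(0)`, the times between
resets, and for every `m` the durations that drive the motion after the `m`-th reset. -/
abbrev Sample : Type := Bool × (ℕ → ℝ) × (ℕ → Bool → ℕ → ℝ)

/-- The position `X̃(t)` with resets: the motion started at `0` with velocity `V(0)` by the last
reset before `t`, at the time elapsed since that reset. -/
def resetPosition (v₁ v₂ : ℝ) (t : ℝ) (ω : Sample) : ℝ :=
  let M := countEpochs (resetEpoch ω.2.1) t
  position v₁ v₂ ω.1 (ω.2.2 M) (t - resetEpoch ω.2.1 M)

/-- The position `X(t)` of the same particle if no resets take place. -/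
def freePosition (v₁ v₂ : ℝ) (t : ℝ) (ω : Sample) : ℝ :=
  position v₁ v₂ ω.1 (ω.2.2 0) t

/-! ### Laws -/

/-- Law of the sequence of intertimes of a geometric counting process with intensity `lam`, i.e.
of the Poisson process whose rate is mixed by the exponential distribution with mean `lam`:
the rate `p.1` is exponential with mean `lam`, and given the rate the intertimes `p.2 n / p.1`
are independent and exponential with that rate. -/
def gcpIntertimeLaw (lam : ℝ) : Measure (ℕ → ℝ) :=
  ((expMeasure lam⁻¹).prod (Measure.infinitePi fun _ : ℕ => expMeasure 1)).map
    fun p n => p.2 n / p.1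

/-- The law of the initial velocity index: `v₁` with probability `q`, `v₂` with probability
`1 - q`. -/
def initialLaw (q : ℝ) : Measure Bool :=
  ENNReal.ofReal q • Measure.dirac true + ENNReal.ofReal (1 - q) • Measure.dirac false

/-- The probability measure of the model: independent initial velocity, Poisson resets with rate
`ξ`, and independent copies of the motion after each reset, each of which is driven by two
independent geometric counting processes with intensity `lam`, one for each velocity. -/
def sampleLaw (q ξ lam : ℝ) : Measure Sample :=
  (initialLaw q).prod ((Measure.infinitePi fun _ : ℕ => expMeasure ξ).prod
    (Measure.infinitePi fun _ : ℕ => Measure.pi fun _ : Bool => gcpIntertimeLaw lam))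

/-- The law of `X̃(t)` with random initial velocity. -/
def resetLaw (v₁ v₂ q ξ lam t : ℝ) : Measure ℝ :=
  (sampleLaw q ξ lam).map (resetPosition v₁ v₂ t)

/-- The law of `X(t)`, the position without resets, with random initial velocity. (It does not
depend on `ξ`, so the rate of the unused resets is set to `1`.) -/
def freeLaw (v₁ v₂ q lam t : ℝ) : Measure ℝ :=
  (sampleLaw q 1 lam).map (freePosition v₁ v₂ t)

/-! ### Densities -/

/-- `μ(dx)/dx = d` at the point `x`. -/
def HasDensityAt (μ : Measure ℝ) (x : ℝ) (d : ℝ≥0∞) : Prop :=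
  Tendsto (fun h : ℝ => μ (Ioo (x - h) (x + h)) / ENNReal.ofReal (2 * h)) (𝓝[>] 0) (𝓝 d)

/-- `f` is the density of `μ` on `U`: on `U` the measure `μ` is absolutely continuous with density
`f`, and at each point of `U` the value of `f` is the derivative `μ(dx)/dx`. The second part
determines `f` on `U`. -/
structure IsDensityOn (μ : Measure ℝ) (U : Set ℝ) (f : ℝ → ℝ≥0∞) : Prop where
  measurable : Measurable f
  restrict_eq : μ.restrict U = (volume.withDensity f).restrict U
  hasDensityAt : ∀ x ∈ U, HasDensityAt μ x (f x)

/-- The generalized incomplete Gamma function `∫_{z₀}^{z₁} u^(a-1) e^(-u) du` for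
`0 ≤ z₀ ≤ z₁`, with values in `[0, ∞]`. -/
def genIncGamma (a z₀ z₁ : ℝ) : ℝ≥0∞ :=
  ∫⁻ u in Ioo z₀ z₁, ENNReal.ofReal (u ^ (a - 1) * Real.exp (-u))

/-- The function `Γ^ξ(x,t)`, for `v₂ < 0 < v₁` (first case) and `0 < v₂ < v₁` (second case). -/
def limitGamma (v₁ v₂ ξ t x : ℝ) : ℝ≥0∞ :=
  if v₂ < 0 then genIncGamma 0 (max (x / v₁) (x / v₂) * ξ) (t * ξ)
  else genIncGamma 0 (x / v₁ * ξ) (min (x / v₂) t * ξ)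

/-- The limiting density
`1{v₂t < x < v₁t} e^(-ξt) / ((v₁-v₂)t) + ξ/(v₁-v₂) 1{min(v₂t,0) < x < v₁t} Γ^ξ(x,t)`. -/
def limitDensity (v₁ v₂ ξ t x : ℝ) : ℝ≥0∞ :=
  (Ioo (v₂ * t) (v₁ * t)).indicator
      (fun _ => ENNReal.ofReal (Real.exp (-ξ * t) / ((v₁ - v₂) * t))) x
    + ENNReal.ofReal (ξ / (v₁ - v₂)) *
      (Ioo (min (v₂ * t) 0) (v₁ * t)).indicator (limitGamma v₁ v₂ ξ t) x

/-- The density of the uniform distribution on `(v₂t, v₁t)`. -/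
def uniformDensity (v₁ v₂ t x : ℝ) : ℝ≥0∞ :=
  (Ioo (v₂ * t) (v₁ * t)).indicator (fun _ => ENNReal.ofReal (1 / ((v₁ - v₂) * t))) x

/-- The interval `(min(v₂t,0), v₁t)` without the point `v₂t`; for `v₂ < 0` it is `(v₂t, v₁t)`, for
`v₂ > 0` it is `(0, v₂t) ∪ (v₂t, v₁t)`. -/
def densityDomain (v₁ v₂ t : ℝ) : Set ℝ := Ioo (min (v₂ * t) 0) (v₁ * t) \ {v₂ * t}

end GCPTelegraph

end

namespace GCPTelegraph

/-! ### Exponential distributions and sums of independent variables -/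

/-! A GCP is a Poisson process with an exponential rate, so its count up to time `a` is geometric:
the `k`-th epoch is at most `a` with probability `r ^ k`, where `r = lam * a / (1 + lam * a)`
(`gcp_sum_le`). Let `T` be the time spent with the initial velocity up to `t`. If exactly `k` of the
intervals with that velocity fit into `a`, then `T > a` iff the first `k` intervals with the other
velocity have total length below `t - a` (`lt_phaseTime_iff`). Summing a geometric series gives `P(T
> a) = (1 + lam * (t - a)) / (1 + lam * t)`, which is affine in `a`. Hence `T` is uniform on `(0,
t)` apart from an atom at `t`. The position is affine in `T`, so without resets it has constant
density `lam / ((1 + lam * t) * (v₁ - v₂))` on `(v₂ t, v₁ t)`, plus an atom at the end point reached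
by the unperturbed motion (`lintegral_position`).

With resets, the position is that of a fresh motion observed at the age `s` since the last reset.
This age is exponential with rate `ξ`, truncated at `t` with an atom there (`lintegral_age`). Mixing
over the age gives the explicit `resetDensity`: the uniform part at age `t`, the integral of the
uniform parts over `s < t` (`coneDensity`), and the atoms at `v₁ s` and `v₂ s` smeared out over `s`.

As `lam → ∞`, `lam / (1 + lam * s)` increases to `1 / s`, so monotone convergence turns
`coneDensity` into an incomplete Gamma integral over the ages at which `x` is reachable
(`coneLimit_eq`), while the smeared atoms vanish for `x ≠ 0`. At `x = 0` the integral of `exp (-(ξ *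
s)) / s` diverges at `0`, and both sides are infinite. -/

theorem lintegral_expMeasure {r : ℝ} (f : ℝ → ℝ≥0∞) (hf : Measurable f) :
    ∫⁻ x, f x ∂(expMeasure r) =
      ∫⁻ x in Ioi 0, ENNReal.ofReal (r * Real.exp (-(r * x))) * f x := by
  have h1 : expMeasure r = volume.withDensity (exponentialPDF r) := rfl
  have h2 : Measurable (exponentialPDF r) := by unfold exponentialPDF; fun_prop
  rw [h1, lintegral_withDensity_eq_lintegral_mul _ h2 hf, ← lintegral_indicator measurableSet_Ioi]
  refine lintegral_congr_ae ?_
  have h0 : ∀ᵐ x : ℝ, x ≠ 0 := by simp [ae_iff]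
  filter_upwards [h0] with x hx
  rcases lt_or_gt_of_ne hx with h | h
  · simp [exponentialPDF_of_neg h, h.le]
  · simp [exponentialPDF_of_nonneg h.le, h]

theorem expMeasure_Iic {r : ℝ} (hr : 0 < r) {x : ℝ} (hx : 0 ≤ x) :
    expMeasure r (Iic x) = ENNReal.ofReal (1 - Real.exp (-(r * x))) := by
  have h1 : expMeasure r = volume.withDensity (exponentialPDF r) := rfl
  rw [h1, withDensity_apply _ measurableSet_Iic, lintegral_exponentialPDF_eq_antiDeriv hr, if_pos hx]

theorem expMeasure_Ioi {r : ℝ} (hr : 0 < r) {x : ℝ} (hx : 0 ≤ x) :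
    expMeasure r (Ioi x) = ENNReal.ofReal (Real.exp (-(r * x))) := by
  have := isProbabilityMeasure_expMeasure hr
  have h : Real.exp (-(r * x)) ≤ 1 := Real.exp_le_one_iff.2 (by nlinarith)
  rw [← compl_Iic, prob_compl_eq_one_sub measurableSet_Iic, expMeasure_Iic hr hx,
    ← ENNReal.ofReal_one, ← ENNReal.ofReal_sub _ (by linarith)]
  congr 1; ring

theorem expMeasure_Ici {r : ℝ} (hr : 0 < r) {x : ℝ} (hx : 0 ≤ x) :
    expMeasure r (Ici x) = ENNReal.ofReal (Real.exp (-(r * x))) := by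
  have h1 : expMeasure r = volume.withDensity (exponentialPDF r) := rfl
  rw [← expMeasure_Ioi hr hx]
  refine measure_congr ?_
  have : expMeasure r ≪ volume := h1 ▸ withDensity_absolutelyContinuous _ _
  exact this.ae_eq Ioi_ae_eq_Ici.symm

theorem ae_expMeasure_pos {r : ℝ} (hr : 0 < r) : ∀ᵐ x ∂(expMeasure r), 0 < x := by
  rw [ae_iff]
  have : {x : ℝ | ¬ 0 < x} = Iic 0 := by ext; simp
  rw [this, expMeasure_Iic hr le_rfl]; simp

/-- Read off from the total mass `1` of `expMeasure c`, which avoids computing an improper integral.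
-/
theorem lintegral_exp_neg_mul {c : ℝ} (hc : 0 < c) :
    ∫⁻ x in Ioi (0 : ℝ), ENNReal.ofReal (Real.exp (-(c * x))) = ENNReal.ofReal c⁻¹ := by
  have := isProbabilityMeasure_expMeasure hc
  have h := lintegral_expMeasure (r := c) (fun _ => 1) measurable_const
  simp only [lintegral_const, measure_univ, mul_one] at h
  have h2 : ∀ x : ℝ, ENNReal.ofReal (c * Real.exp (-(c * x))) =
    ENNReal.ofReal c * ENNReal.ofReal (Real.exp (-(c * x))) := fun x => ENNReal.ofReal_mul hc.le
  simp_rw [h2] at h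
  rw [lintegral_const_mul _ (by fun_prop)] at h
  rw [ENNReal.ofReal_inv_of_pos hc]
  exact ENNReal.eq_inv_of_mul_eq_one_left (by rw [mul_comm]; exact h.symm)

theorem laplace_expMeasure {r c : ℝ} (hr : 0 < r) (hc : 0 ≤ c) :
    ∫⁻ x, ENNReal.ofReal (Real.exp (-(c * x))) ∂(expMeasure r) = ENNReal.ofReal (r / (r + c)) := by
  rw [lintegral_expMeasure _ (by fun_prop)]
  have h2 : ∀ x : ℝ, ENNReal.ofReal (r * Real.exp (-(r * x))) * ENNReal.ofReal (Real.exp (-(c * x))) =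
      ENNReal.ofReal r * ENNReal.ofReal (Real.exp (-((r + c) * x))) := fun x => by
    rw [← ENNReal.ofReal_mul (by positivity), ← ENNReal.ofReal_mul hr.le, mul_assoc, ← Real.exp_add]
    ring_nf
  simp_rw [h2]
  rw [lintegral_const_mul _ (by fun_prop), lintegral_exp_neg_mul (by linarith),
    ← ENNReal.ofReal_mul hr.le, div_eq_mul_inv]

/-- The partial sum of the first `m` coordinates is independent of the next coordinate. -/
theorem lintegral_sum_range_next (ν : Measure ℝ) [IsProbabilityMeasure ν] (m : ℕ)
    (F : ℝ × ℝ → ℝ≥0∞) (hF : Measurable F) :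
    ∫⁻ R, F (∑ i ∈ Finset.range m, R i, R m) ∂(Measure.infinitePi fun _ : ℕ => ν) =
      ∫⁻ R, ∫⁻ r, F (∑ i ∈ Finset.range m, R i, r) ∂ν ∂(Measure.infinitePi fun _ : ℕ => ν) := by
  have hind := iIndepFun_infinitePi (P := fun _ : ℕ => ν) (X := fun _ x => x)
    (fun _ => measurable_id)
  have h2 := hind.indepFun_finsetSum_of_notMem (fun i => measurable_pi_apply i)
    (s := Finset.range m) (i := m) (by simp)
  have hm : Measurable fun R : ℕ → ℝ => ∑ i ∈ Finset.range m, R i := by fun_prop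
  have h3 : (Measure.infinitePi fun _ : ℕ => ν).map
      (fun R => (∑ i ∈ Finset.range m, R i, R m)) =
      ((Measure.infinitePi fun _ : ℕ => ν).map fun R => ∑ i ∈ Finset.range m, R i).prod ν := by
    have := (indepFun_iff_map_prod_eq_prod_map_map (by fun_prop)
      (measurable_pi_apply m).aemeasurable).1 h2
    rw [Measure.infinitePi_map_eval (μ := fun _ : ℕ => ν) m] at this
    simpa [Finset.sum_apply, Finset.sum_fn] using this
  rw [← lintegral_map hF (by fun_prop), h3, lintegral_prod _ hF.aemeasurable,
    lintegral_map hF.lintegral_prod_right' hm]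

theorem laplace_sum_range {r c : ℝ} (hr : 0 < r) (hc : 0 ≤ c) (m : ℕ) :
    ∫⁻ R, ENNReal.ofReal (Real.exp (-(c * ∑ i ∈ Finset.range m, R i)))
      ∂(Measure.infinitePi fun _ : ℕ => expMeasure r) = ENNReal.ofReal ((r / (r + c)) ^ m) := by
  have := isProbabilityMeasure_expMeasure hr
  induction m with
  | zero => simp
  | succ m ih =>
    have h := lintegral_sum_range_next (expMeasure r) m
      (fun p => ENNReal.ofReal (Real.exp (-(c * (p.1 + p.2))))) (by fun_prop)
    simp_rw [Finset.sum_range_succ]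
    rw [h]
    have h2 : ∀ x y : ℝ, ENNReal.ofReal (Real.exp (-(c * (x + y)))) =
      ENNReal.ofReal (Real.exp (-(c * x))) * ENNReal.ofReal (Real.exp (-(c * y))) := fun x y => by
      rw [← ENNReal.ofReal_mul (by positivity), ← Real.exp_add]; ring_nf
    simp_rw [h2]
    have h3 : ∀ x : ℝ, ∫⁻ y, ENNReal.ofReal (Real.exp (-(c * x))) *
      ENNReal.ofReal (Real.exp (-(c * y))) ∂(expMeasure r) =
        ENNReal.ofReal (Real.exp (-(c * x))) * ENNReal.ofReal (r / (r + c)) := fun x => by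
      rw [lintegral_const_mul _ (by fun_prop), laplace_expMeasure hr hc]
    simp_rw [h3]
    rw [lintegral_mul_const _ (by fun_prop), ih, ← ENNReal.ofReal_mul (by positivity), pow_succ]

theorem ae_infinitePi_forall {α : Type*} [MeasurableSpace α] (ν : Measure α)
    [IsProbabilityMeasure ν] {p : α → Prop} (h : ∀ᵐ x ∂ν, p x) :
    ∀ᵐ R ∂(Measure.infinitePi fun _ : ℕ => ν), ∀ n, p (R n) := by
  rw [ae_all_iff]
  intro n
  exact (measurePreserving_eval_infinitePi (fun _ : ℕ => ν) n).quasiMeasurePreserving.ae h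

/-! ### Partial sums of the intertimes of a geometric counting process -/

theorem measurable_gcp_map : Measurable fun (p : ℝ × (ℕ → ℝ)) (n : ℕ) => p.2 n / p.1 := by
  refine measurable_pi_lambda _ fun n => ?_
  exact ((measurable_pi_apply n).comp measurable_snd).div measurable_fst

theorem isProbabilityMeasure_gcpIntertimeLaw {lam : ℝ} (hl : 0 < lam) :
    IsProbabilityMeasure (gcpIntertimeLaw lam) := by
  have := isProbabilityMeasure_expMeasure (inv_pos.2 hl)
  have := isProbabilityMeasure_expMeasure one_pos
  exact Measure.isProbabilityMeasure_map measurable_gcp_map.aemeasurable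

theorem ae_gcpIntertimeLaw_pos {lam : ℝ} (hl : 0 < lam) :
    ∀ᵐ S ∂(gcpIntertimeLaw lam), ∀ n, 0 < S n := by
  have := isProbabilityMeasure_expMeasure (inv_pos.2 hl)
  have := isProbabilityMeasure_expMeasure one_pos
  have hm : MeasurableSet {S : ℕ → ℝ | ∀ n, 0 < S n} := by
    simp only [ofPred_forall]
    exact MeasurableSet.iInter fun n => measurableSet_lt measurable_const (measurable_pi_apply n)
  rw [gcpIntertimeLaw, ae_map_iff measurable_gcp_map.aemeasurable hm]
  have h1 := (Measure.quasiMeasurePreserving_fst (μ := expMeasure lam⁻¹)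
    (ν := Measure.infinitePi fun _ : ℕ => expMeasure 1)).ae (ae_expMeasure_pos (inv_pos.2 hl))
  have h2 := (Measure.quasiMeasurePreserving_snd (μ := expMeasure lam⁻¹)
    (ν := Measure.infinitePi fun _ : ℕ => expMeasure 1)).ae
    (ae_infinitePi_forall _ (ae_expMeasure_pos one_pos))
  filter_upwards [h1, h2] with p hp1 hp2 n
  exact div_pos (hp2 n) hp1

/-- Given the unit exponentials `e`, the event `∑ e i / x ≤ a` says that the rate `x` is at least
`(∑ e i) / a`, which has probability `exp (-(∑ e i) / (lam * a))`. Averaging over `e` is a Laplace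
transform of a sum of `k` unit exponentials, hence a `k`-th power. The set `B` is left general to
serve both the strict and the weak inequality. -/
theorem gcp_mixing {lam a : ℝ} (hl : 0 < lam) (ha : 0 < a) (k : ℕ) {B : Set (ℕ → ℝ)}
    (hB : MeasurableSet B)
    (h : ∀ e : ℕ → ℝ, (∀ n, 0 < e n) →
      expMeasure lam⁻¹ ((fun x => fun n => e n / x) ⁻¹' B) =
        expMeasure lam⁻¹ (Ici ((∑ i ∈ Finset.range k, e i) / a))) :
    gcpIntertimeLaw lam B = ENNReal.ofReal ((lam * a / (1 + lam * a)) ^ k) := by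
  have := isProbabilityMeasure_expMeasure (inv_pos.2 hl)
  have := isProbabilityMeasure_expMeasure one_pos
  rw [gcpIntertimeLaw, Measure.map_apply measurable_gcp_map hB,
    Measure.prod_apply_symm (measurable_gcp_map hB)]
  have h1 : (1 : ℝ) / (1 + 1 / (lam * a)) = lam * a / (1 + lam * a) := by field_simp; ring
  rw [← h1, ← laplace_sum_range one_pos (by positivity)]
  refine lintegral_congr_ae ?_
  filter_upwards [ae_infinitePi_forall _ (ae_expMeasure_pos one_pos)] with e he
  have hs : 0 ≤ (∑ i ∈ Finset.range k, e i) / a :=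
    div_nonneg (Finset.sum_nonneg fun i _ => (he i).le) ha.le
  have h2 := h e he
  rw [expMeasure_Ici (inv_pos.2 hl) hs] at h2
  refine Eq.trans h2 ?_
  congr 2
  field_simp

theorem measurable_sum_range (k : ℕ) :
    Measurable fun S : ℕ → ℝ => ∑ i ∈ Finset.range k, S i :=
  Finset.measurable_sum _ fun i _ => measurable_pi_apply i

theorem gcp_sum_le {lam a : ℝ} (hl : 0 < lam) (ha : 0 < a) (k : ℕ) :
    gcpIntertimeLaw lam {S | ∑ i ∈ Finset.range k, S i ≤ a} =
      ENNReal.ofReal ((lam * a / (1 + lam * a)) ^ k) := by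
  refine gcp_mixing hl ha k (measurableSet_le (measurable_sum_range k) measurable_const) ?_
  intro e he
  refine measure_congr ?_
  filter_upwards [ae_expMeasure_pos (inv_pos.2 hl)] with x hx
  refine propext ?_
  change (∑ i ∈ Finset.range k, e i / x ≤ a) ↔ (∑ i ∈ Finset.range k, e i) / a ≤ x
  rw [← Finset.sum_div, div_le_iff₀ hx, div_le_iff₀ ha, mul_comm]

theorem gcp_sum_lt {lam a : ℝ} (hl : 0 < lam) (ha : 0 < a) (k : ℕ) :
    gcpIntertimeLaw lam {S | ∑ i ∈ Finset.range k, S i < a} =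
      ENNReal.ofReal ((lam * a / (1 + lam * a)) ^ k) := by
  refine gcp_mixing hl ha k (measurableSet_lt (measurable_sum_range k) measurable_const) ?_
  intro e he
  have hs : 0 ≤ (∑ i ∈ Finset.range k, e i) / a :=
    div_nonneg (Finset.sum_nonneg fun i _ => (he i).le) ha.le
  -- The rate has no atoms, so the strict event has the same probability as the weak one.
  rw [expMeasure_Ici (inv_pos.2 hl) hs, ← expMeasure_Ioi (inv_pos.2 hl) hs]
  refine measure_congr ?_
  filter_upwards [ae_expMeasure_pos (inv_pos.2 hl)] with x hx
  refine propext ?_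
  change (∑ i ∈ Finset.range k, e i / x < a) ↔ (∑ i ∈ Finset.range k, e i) / a < x
  rw [← Finset.sum_div, div_lt_iff₀ hx, div_lt_iff₀ ha, mul_comm]

theorem gcp_ratio_mem {lam a : ℝ} (hl : 0 < lam) (ha : 0 < a) :
    0 < lam * a / (1 + lam * a) ∧ lam * a / (1 + lam * a) < 1 := by
  have : 0 < lam * a := by positivity
  exact ⟨by positivity, by rw [div_lt_one (by positivity)]; linarith⟩

/-- Difference of two consecutive events of `gcp_sum_le`; they are nested only almost surely, by
positivity of the intertimes. -/
theorem gcp_count_eq {lam a : ℝ} (hl : 0 < lam) (ha : 0 < a) (k : ℕ) :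
    gcpIntertimeLaw lam {S | ∑ i ∈ Finset.range k, S i ≤ a ∧ a < ∑ i ∈ Finset.range (k + 1), S i} =
      ENNReal.ofReal ((lam * a / (1 + lam * a)) ^ k * (1 - lam * a / (1 + lam * a))) := by
  have := isProbabilityMeasure_gcpIntertimeLaw hl
  obtain ⟨hr0, hr1⟩ := gcp_ratio_mem hl ha
  have h1 : {S : ℕ → ℝ | ∑ i ∈ Finset.range k, S i ≤ a ∧ a < ∑ i ∈ Finset.range (k + 1), S i} =
    {S | ∑ i ∈ Finset.range k, S i ≤ a} \ {S | ∑ i ∈ Finset.range (k + 1), S i ≤ a} := by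
    ext S; simp
  have hm : MeasurableSet {S : ℕ → ℝ | ∑ i ∈ Finset.range (k + 1), S i ≤ a} :=
    measurableSet_le (measurable_sum_range _) measurable_const
  have hsub : {S : ℕ → ℝ | ∑ i ∈ Finset.range (k + 1), S i ≤ a} ≤ᵐ[gcpIntertimeLaw lam]
      {S | ∑ i ∈ Finset.range k, S i ≤ a} := by
    filter_upwards [ae_gcpIntertimeLaw_pos hl] with S hS h
    change ∑ i ∈ Finset.range (k + 1), S i ≤ a at h
    change ∑ i ∈ Finset.range k, S i ≤ a
    rw [Finset.sum_range_succ] at h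
    linarith [hS k]
  rw [h1, measure_sdiff' _ hm.nullMeasurableSet (measure_ne_top _ _), measure_congr (union_ae_eq_left_iff_ae_subset.2 hsub),
    gcp_sum_le hl ha, gcp_sum_le hl ha, ← ENNReal.ofReal_sub _ (by positivity)]
  congr 1; ring

/-- The hypothesis uses the level `a + 1` because it is positive even for `a = 0`, as `gcp_sum_le`
requires. The index wanted is the predecessor of the first `k` whose sum exceeds `a`; this first `k`
is not `0`, since the empty sum is at most `a`. -/
theorem ae_exists_count (μ : Measure (ℕ → ℝ)) {a : ℝ} (ha : 0 ≤ a)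
    (h : Tendsto (fun k => μ {S | ∑ i ∈ Finset.range k, S i ≤ a + 1}) atTop (𝓝 0)) :
    ∀ᵐ S ∂μ, ∃ k, ∑ i ∈ Finset.range k, S i ≤ a ∧ a < ∑ i ∈ Finset.range (k + 1), S i := by
  have h0 : μ {S | ∀ k, ∑ i ∈ Finset.range k, S i ≤ a + 1} = 0 :=
    le_antisymm (ge_of_tendsto' h fun k => measure_mono fun S hS => hS k) zero_le
  have h1 : ∀ᵐ S ∂μ, ¬ ∀ k, ∑ i ∈ Finset.range k, S i ≤ a + 1 := by
    rw [ae_iff]; simpa using h0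
  filter_upwards [h1] with S hS
  push Not at hS
  classical
  have hex : ∃ k, a < ∑ i ∈ Finset.range k, S i := by
    obtain ⟨k, hk⟩ := hS
    exact ⟨k, by linarith⟩
  have hne : Nat.find hex ≠ 0 := by
    intro h
    have := Nat.find_spec hex
    rw [h] at this
    simp at this
    linarith
  obtain ⟨k, hk⟩ := Nat.exists_eq_succ_of_ne_zero hne
  refine ⟨k, ?_, ?_⟩
  · exact not_lt.1 (Nat.find_min hex (by omega))
  · have := Nat.find_spec hex
    rwa [hk] at this

theorem ae_gcp_exists_count {lam a : ℝ} (hl : 0 < lam) (ha : 0 ≤ a) :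
    ∀ᵐ S ∂(gcpIntertimeLaw lam),
      ∃ k, ∑ i ∈ Finset.range k, S i ≤ a ∧ a < ∑ i ∈ Finset.range (k + 1), S i := by
  have hp : 0 < a + 1 := by linarith
  obtain ⟨hr0, hr1⟩ := gcp_ratio_mem hl hp
  refine ae_exists_count _ ha ?_
  simp_rw [gcp_sum_le hl hp]
  simpa using ENNReal.tendsto_ofReal (tendsto_pow_atTop_nhds_zero_of_lt_one hr0.le hr1)

/-! ### Sample paths -/

theorem measurable_countEpochs : Measurable fun p : (ℕ → ℝ) × ℝ => countEpochs p.1 p.2 := by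
  have h : Measurable fun p : (ℕ → ℝ) × ℝ => {n : ℕ | p.1 (n + 1) ≤ p.2} :=
    measurable_pi_lambda _ fun n => measurableSet_setOfPred.1 (measurableSet_le
      ((measurable_pi_apply (n + 1)).comp measurable_fst) measurable_snd)
  exact measurable_ncard.comp h

/-- The bracket and monotonicity force the counted set to be `range n`, so the value `0` of `ncard`
on infinite sets plays no role. -/
theorem countEpochs_eq {S : ℕ → ℝ} (hS : Monotone S) {s : ℝ} {n : ℕ} (h1 : S n ≤ s)
    (h2 : s < S (n + 1)) : countEpochs S s = n := by
  have : {m : ℕ | S (m + 1) ≤ s} = (Finset.range n : Set ℕ) := by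
    ext m
    simp only [mem_ofPred_eq, Finset.coe_range, mem_Iio]
    refine ⟨fun h => ?_, fun h => (hS h).trans h1⟩
    by_contra hm
    exact absurd (h2.trans_le (hS (by omega : n + 1 ≤ m + 1))) (not_lt.2 h)
  rw [countEpochs, this, Set.ncard_coe_finset, Finset.card_range]

theorem changeEpoch_succ (j : Bool) (D : Bool → ℕ → ℝ) (n : ℕ) :
    changeEpoch j D (n + 1) = changeEpoch j D n + D (phase j n) (n / 2) :=
  Finset.sum_range_succ _ _

theorem changeEpoch_two_mul_succ (j : Bool) (D : Bool → ℕ → ℝ) (k : ℕ) :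
    changeEpoch j D (2 * k + 1) = changeEpoch j D (2 * k) + D j k := by
  rw [changeEpoch_succ, phase, if_pos (even_two_mul k), Nat.mul_div_cancel_left _ two_pos]

theorem changeEpoch_two_mul_add_two (j : Bool) (D : Bool → ℕ → ℝ) (k : ℕ) :
    changeEpoch j D (2 * k + 2) = changeEpoch j D (2 * k + 1) + D (!j) k := by
  have h : (2 * k + 1) / 2 = k := by omega
  rw [changeEpoch_succ, phase, if_neg (by simp), h]

theorem changeEpoch_two_mul (j : Bool) (D : Bool → ℕ → ℝ) (k : ℕ) :
    changeEpoch j D (2 * k) =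
      ∑ i ∈ Finset.range k, D j i + ∑ i ∈ Finset.range k, D (!j) i := by
  induction k with
  | zero => simp [changeEpoch]
  | succ k ih =>
    rw [mul_add, mul_one, changeEpoch_two_mul_add_two, changeEpoch_two_mul_succ, ih,
      Finset.sum_range_succ, Finset.sum_range_succ]
    ring

theorem monotone_changeEpoch (j : Bool) {D : Bool → ℕ → ℝ} (hD : ∀ b n, 0 < D b n) :
    Monotone (changeEpoch j D) :=
  monotone_nat_of_le_succ fun n => by rw [changeEpoch_succ]; linarith [hD (phase j n) (n / 2)]

/-- The indicator of the times at which the velocity is the initial one. -/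
noncomputable def initialPhase (S : ℕ → ℝ) (s : ℝ) : ℝ := if Even (countEpochs S s) then 1 else 0

/-- The time spent with the initial velocity up to time `t`. -/
noncomputable def phaseTime (S : ℕ → ℝ) (t : ℝ) : ℝ := ∫ s in (0 : ℝ)..t, initialPhase S s

theorem measurable_initialPhase :
    Measurable fun p : (ℕ → ℝ) × ℝ => initialPhase p.1 p.2 :=
  (measurable_from_nat (f := fun n => if Even n then (1 : ℝ) else 0)).comp measurable_countEpochs

theorem initialPhase_nonneg (S : ℕ → ℝ) (s : ℝ) : 0 ≤ initialPhase S s := by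
  unfold initialPhase; split_ifs <;> norm_num

theorem initialPhase_le_one (S : ℕ → ℝ) (s : ℝ) : initialPhase S s ≤ 1 := by
  unfold initialPhase; split_ifs <;> norm_num

theorem intervalIntegrable_initialPhase (S : ℕ → ℝ) (a b : ℝ) :
    IntervalIntegrable (initialPhase S) volume a b := by
  refine (intervalIntegrable_const (c := (1 : ℝ))).mono_fun'
    (measurable_initialPhase.comp (measurable_const.prodMk measurable_id)).aestronglyMeasurable ?_
  filter_upwards with s
  rw [Real.norm_of_nonneg (initialPhase_nonneg S s)]
  exact initialPhase_le_one S s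

/-- The end point of the integral varies over all reals, so the interval integral is written as a
difference of two integrals over the whole line, with indicators depending jointly on the end point
and the time. -/
theorem measurable_phaseTime : Measurable fun p : (ℕ → ℝ) × ℝ => phaseTime p.1 p.2 := by
  have h (A : Set (ℝ × ℝ)) (hA : MeasurableSet A) : Measurable fun p : (ℕ → ℝ) × ℝ =>
      ∫ s, A.indicator (fun _ => (1 : ℝ)) (p.2, s) * initialPhase p.1 s := by
    refine (StronglyMeasurable.integral_prod_right (Measurable.stronglyMeasurable ?_)).measurable
    refine Measurable.mul ?_ ?_
    · exact (measurable_const.indicator hA).comp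
        ((measurable_snd.comp measurable_fst).prodMk measurable_snd)
    · exact measurable_initialPhase.comp ((measurable_fst.comp measurable_fst).prodMk measurable_snd)
  have h1 := h {q | q.2 ∈ Ioc 0 q.1} ((measurableSet_lt measurable_const measurable_snd).inter
    (measurableSet_le measurable_snd measurable_fst))
  have h2 := h {q | q.2 ∈ Ioc q.1 0} ((measurableSet_lt measurable_fst measurable_snd).inter
    (measurableSet_le measurable_snd measurable_const))
  convert! h1.sub h2 using 1
  ext p
  rw [Pi.sub_apply, phaseTime, intervalIntegral, ← integral_indicator measurableSet_Ioc,
    ← integral_indicator measurableSet_Ioc]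
  congr 1 <;> refine integral_congr_ae (ae_of_all _ fun s => ?_) <;> simp [Set.indicator]

theorem phaseTime_sub (S : ℕ → ℝ) (a b : ℝ) :
    phaseTime S b - phaseTime S a = ∫ s in a..b, initialPhase S s :=
  intervalIntegral.integral_interval_sub_left (intervalIntegrable_initialPhase S _ _)
    (intervalIntegrable_initialPhase S _ _)

theorem monotone_phaseTime (S : ℕ → ℝ) : Monotone (phaseTime S) := fun a b h => by
  rw [← sub_nonneg, phaseTime_sub]
  exact intervalIntegral.integral_nonneg h fun s _ => initialPhase_nonneg S s

theorem phaseTime_sub_of_eqOn {S : ℕ → ℝ} {a b c : ℝ} (hab : a ≤ b)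
    (h : ∀ s ∈ Ico a b, initialPhase S s = c) : phaseTime S b - phaseTime S a = c * (b - a) := by
  rw [phaseTime_sub]
  have h2 : ∫ s in a..b, initialPhase S s = ∫ _s in a..b, c := by
    -- An epoch is counted from its own instant on, so the phase is constant on left-closed pieces;
    -- this is why `Ico` replaces the usual `Ioc`.
    rw [intervalIntegral.integral_of_le hab, intervalIntegral.integral_of_le hab,
      ← integral_Ico_eq_integral_Ioc, ← integral_Ico_eq_integral_Ioc]
    exact setIntegral_congr_fun measurableSet_Ico h
  rw [h2, intervalIntegral.integral_const, smul_eq_mul, mul_comm]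

theorem phaseTime_sub_even {j : Bool} {D : Bool → ℕ → ℝ} (hD : ∀ b n, 0 < D b n) {k : ℕ}
    {a b : ℝ} (hab : a ≤ b) (ha : changeEpoch j D (2 * k) ≤ a)
    (hb : b ≤ changeEpoch j D (2 * k + 1)) :
    phaseTime (changeEpoch j D) b - phaseTime (changeEpoch j D) a = b - a := by
  rw [phaseTime_sub_of_eqOn hab (c := 1), one_mul]
  intro s hs
  rw [initialPhase, countEpochs_eq (monotone_changeEpoch j hD) (ha.trans hs.1) (hs.2.trans_le hb),
    if_pos (even_two_mul k)]

theorem phaseTime_changeEpoch {j : Bool} {D : Bool → ℕ → ℝ} (hD : ∀ b n, 0 < D b n) (k : ℕ) :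
    phaseTime (changeEpoch j D) (changeEpoch j D (2 * k)) = ∑ i ∈ Finset.range k, D j i := by
  induction k with
  | zero => simp [changeEpoch, phaseTime]
  | succ k ih =>
    have hm := monotone_changeEpoch j hD
    have h1 := phaseTime_sub_even hD (k := k) (hm (Nat.le_succ (2 * k))) le_rfl le_rfl
    have h2 : phaseTime (changeEpoch j D) (changeEpoch j D (2 * k + 2)) -
        phaseTime (changeEpoch j D) (changeEpoch j D (2 * k + 1)) = 0 := by
      rw [phaseTime_sub_of_eqOn (hm (Nat.le_succ (2 * k + 1))) (c := 0), zero_mul]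
      intro s hs
      rw [initialPhase, countEpochs_eq hm hs.1 hs.2, if_neg (by simp)]
    rw [changeEpoch_two_mul_succ] at h1
    rw [mul_add, mul_one, Finset.sum_range_succ, ← ih]
    rw [changeEpoch_two_mul_succ] at h2
    linarith

/-- The time `a + W` lies in the `k`-th interval run with the initial velocity, between `changeEpoch
j D (2 * k)` and `changeEpoch j D (2 * k + 1)`. There `phaseTime` equals `a`, and it grows at unit
speed immediately afterwards. So level `a` is exceeded exactly after time `a + W`. The two sides
involve independent sequences of durations. -/
theorem lt_phaseTime_iff {j : Bool} {D : Bool → ℕ → ℝ} (hD : ∀ b n, 0 < D b n) {k : ℕ} {a t : ℝ}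
    (h1 : ∑ i ∈ Finset.range k, D j i ≤ a) (h2 : a < ∑ i ∈ Finset.range (k + 1), D j i) :
    a < phaseTime (changeEpoch j D) t ↔ ∑ i ∈ Finset.range k, D (!j) i < t - a := by
  set W := ∑ i ∈ Finset.range k, D (!j) i with hW
  have hT0 := changeEpoch_two_mul j D k
  have hT1 := changeEpoch_two_mul_succ j D k
  rw [Finset.sum_range_succ] at h2
  have hτ : phaseTime (changeEpoch j D) (a + W) = a := by
    have := phaseTime_sub_even hD (j := j) (k := k) (a := changeEpoch j D (2 * k)) (b := a + W)
      (by linarith) le_rfl (by linarith)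
    rw [phaseTime_changeEpoch hD] at this
    linarith
  constructor
  · intro h
    by_contra hc
    have := monotone_phaseTime (changeEpoch j D) (show t ≤ a + W by linarith)
    linarith
  · intro h
    -- Capping `t` at the next change keeps the comparison inside the interval of unit growth;
    -- monotonicity then carries the bound to `t`.
    have hlt : a + W < min t (changeEpoch j D (2 * k + 1)) := lt_min (by linarith) (by linarith)
    have h3 := phaseTime_sub_even hD (j := j) (k := k) hlt.le (by linarith) (min_le_right _ _)
    have h4 := monotone_phaseTime (changeEpoch j D) (min_le_left t (changeEpoch j D (2 * k + 1)))
    linarith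

theorem position_eq (v₁ v₂ : ℝ) (j : Bool) (D : Bool → ℕ → ℝ) (t : ℝ) :
    position v₁ v₂ j D t = velocityOf v₁ v₂ (!j) * t +
      (velocityOf v₁ v₂ j - velocityOf v₁ v₂ (!j)) * phaseTime (changeEpoch j D) t := by
  have h : ∀ s, velocity v₁ v₂ j D s = velocityOf v₁ v₂ (!j) +
      (velocityOf v₁ v₂ j - velocityOf v₁ v₂ (!j)) * initialPhase (changeEpoch j D) s := by
    intro s
    rw [velocity, initialPhase, phase]
    split_ifs <;> ring
  rw [position, phaseTime, ← intervalIntegral.integral_const_mul]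
  simp_rw [h]
  rw [intervalIntegral.integral_add intervalIntegrable_const
    ((intervalIntegrable_initialPhase _ _ _).const_mul _), intervalIntegral.integral_const]
  simp [mul_comm]

theorem measurable_changeEpoch (j : Bool) : Measurable (changeEpoch j) :=
  measurable_pi_lambda _ fun _ => Finset.measurable_sum _ fun k _ =>
    (measurable_pi_apply (k / 2)).comp (measurable_pi_apply (phase j k))

theorem measurable_phaseTime_changeEpoch (j : Bool) :
    Measurable fun p : (Bool → ℕ → ℝ) × ℝ => phaseTime (changeEpoch j p.1) p.2 := by
  have h1 : Measurable fun p : (Bool → ℕ → ℝ) × ℝ => changeEpoch j p.1 :=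
      (measurable_changeEpoch j).comp measurable_fst
  have h2 : Measurable fun p : (Bool → ℕ → ℝ) × ℝ => (changeEpoch j p.1, p.2) :=
    h1.prodMk measurable_snd
  have h3 := Measurable.comp measurable_phaseTime h2
  simpa only [Function.comp_def] using h3

theorem measurable_phaseTime_right (j : Bool) (t : ℝ) :
    Measurable fun D : Bool → ℕ → ℝ => phaseTime (changeEpoch j D) t := by
  have h := Measurable.comp (measurable_phaseTime_changeEpoch j)
    (measurable_prodMk_right (y := t) : Measurable fun D : Bool → ℕ → ℝ => (D, t))
  simpa only [Function.comp_def] using h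

theorem measurable_position (v₁ v₂ : ℝ) (j : Bool) :
    Measurable fun p : (Bool → ℕ → ℝ) × ℝ => position v₁ v₂ j p.1 p.2 := by
  simp_rw [position_eq]
  exact (measurable_snd.const_mul _).add ((measurable_phaseTime_changeEpoch j).const_mul _)

/-! ### The law of the motion without resets -/

/-- The law of the durations that drive the motion. -/
noncomputable def motionLaw (lam : ℝ) : Measure (Bool → ℕ → ℝ) :=
  Measure.pi fun _ : Bool => gcpIntertimeLaw lam

theorem isProbabilityMeasure_motionLaw {lam : ℝ} (hl : 0 < lam) :
    IsProbabilityMeasure (motionLaw lam) := by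
  have := isProbabilityMeasure_gcpIntertimeLaw hl
  unfold motionLaw; infer_instance

theorem map_eval_motionLaw {lam : ℝ} (hl : 0 < lam) (b : Bool) :
    (motionLaw lam).map (fun D => D b) = gcpIntertimeLaw lam := by
  have := isProbabilityMeasure_gcpIntertimeLaw hl
  exact (measurePreserving_eval (fun _ : Bool => gcpIntertimeLaw lam) b).map_eq

theorem ae_motionLaw_of_ae {lam : ℝ} (hl : 0 < lam) (b : Bool) {p : (ℕ → ℝ) → Prop}
    (h : ∀ᵐ S ∂(gcpIntertimeLaw lam), p S) : ∀ᵐ D ∂(motionLaw lam), p (D b) := by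
  rw [← map_eval_motionLaw hl b] at h
  exact ae_of_ae_map (measurable_pi_apply b).aemeasurable h

theorem ae_motionLaw_pos {lam : ℝ} (hl : 0 < lam) :
    ∀ᵐ D ∂(motionLaw lam), ∀ b n, 0 < D b n :=
  ae_all_iff.2 fun b => ae_motionLaw_of_ae hl b (ae_gcpIntertimeLaw_pos hl)

theorem motionLaw_inter {lam : ℝ} (hl : 0 < lam) (j : Bool) (A B : Set (ℕ → ℝ)) :
    motionLaw lam {D | D j ∈ A ∧ D (!j) ∈ B} = gcpIntertimeLaw lam A * gcpIntertimeLaw lam B := by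
  have := isProbabilityMeasure_gcpIntertimeLaw hl
  have h : {D : Bool → ℕ → ℝ | D j ∈ A ∧ D (!j) ∈ B} =
      Set.univ.pi fun b => if b = j then A else B := by
    ext D
    cases j <;> simp [and_comm]
  rw [h, motionLaw, Measure.pi_pi]
  cases j <;> simp [mul_comm]

theorem measurableSet_count (k : ℕ) (a : ℝ) : MeasurableSet
    {S : ℕ → ℝ | ∑ i ∈ Finset.range k, S i ≤ a ∧ a < ∑ i ∈ Finset.range (k + 1), S i} :=
  (measurableSet_le (measurable_sum_range k) measurable_const).inter
    (measurableSet_lt measurable_const (measurable_sum_range (k + 1)))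

theorem geometric_sum_identity {lam a b : ℝ} (hl : 0 < lam) (ha : 0 < a) (hb : 0 < b) :
    (1 - lam * a / (1 + lam * a)) * (1 - lam * a / (1 + lam * a) * (lam * b / (1 + lam * b)))⁻¹ =
      (1 + lam * b) / (1 + lam * (a + b)) := by
  have h1 : 0 < lam * a := by positivity
  have h2 : 0 < lam * b := by positivity
  have h3 : 1 - lam * a / (1 + lam * a) = 1 / (1 + lam * a) := by field_simp; ring
  have h4 : 1 - lam * a / (1 + lam * a) * (lam * b / (1 + lam * b)) =
      (1 + lam * (a + b)) / ((1 + lam * a) * (1 + lam * b)) := by field_simp; ring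
  rw [h3, h4, inv_div]
  field_simp

/-- Split according to the number `k` of initial-velocity intervals completed by `a`. With `r` and
`s` the geometric ratios at `a` and `t - a`, independence gives the terms `(1 - r) * r ^ k * s ^ k`,
whose sum is evaluated by `geometric_sum_identity`. -/
theorem motionLaw_lt_phaseTime {lam a t : ℝ} (hl : 0 < lam) (ha : 0 < a) (hat : a < t) (j : Bool) :
    motionLaw lam {D | a < phaseTime (changeEpoch j D) t} =
      ENNReal.ofReal ((1 + lam * (t - a)) / (1 + lam * t)) := by
  have := isProbabilityMeasure_motionLaw hl
  have hb : 0 < t - a := sub_pos.2 hat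
  set C : ℕ → Set (ℕ → ℝ) := fun k =>
    {S | ∑ i ∈ Finset.range k, S i ≤ a ∧ a < ∑ i ∈ Finset.range (k + 1), S i} with hC
  set E : ℕ → Set (Bool → ℕ → ℝ) := fun k =>
    {D | D j ∈ C k ∧ D (!j) ∈ {S | ∑ i ∈ Finset.range k, S i < t - a}} with hE
  have hmW (k : ℕ) : MeasurableSet {S : ℕ → ℝ | ∑ i ∈ Finset.range k, S i < t - a} :=
    measurableSet_lt (measurable_sum_range k) measurable_const
  have hEm (k : ℕ) : MeasurableSet (E k) :=
    ((measurable_pi_apply (X := fun _ : Bool => ℕ → ℝ) j) (measurableSet_count k a)).inter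
      ((measurable_pi_apply (X := fun _ : Bool => ℕ → ℝ) (!j)) (hmW k))
  have h1 : {D | a < phaseTime (changeEpoch j D) t} =ᵐ[motionLaw lam] ⋃ k, E k := by
    filter_upwards [ae_motionLaw_pos hl, ae_motionLaw_of_ae hl j (ae_gcp_exists_count hl ha.le)]
      with D hD hk
    refine propext ?_
    change (a < phaseTime (changeEpoch j D) t) ↔ D ∈ ⋃ k, E k
    rw [mem_iUnion]
    constructor
    · intro h
      obtain ⟨k, hk1, hk2⟩ := hk
      exact ⟨k, ⟨hk1, hk2⟩, (lt_phaseTime_iff hD hk1 hk2).1 h⟩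
    · rintro ⟨k, ⟨hk1, hk2⟩, h⟩
      exact (lt_phaseTime_iff hD hk1 hk2).2 h
  -- The count is unique only where all durations are positive, so the pieces are disjoint up to a
  -- null set.
  have hdisj : Pairwise (Function.onFun (AEDisjoint (motionLaw lam)) E) := by
    have key : ∀ D : Bool → ℕ → ℝ, (∀ b n, 0 < D b n) → ∀ k l, k < l → D j ∈ C k → D j ∉ C l := by
      rintro D hD k l hkl ⟨_, h2⟩ ⟨h3, _⟩
      have hm : Monotone fun n => ∑ i ∈ Finset.range n, D j i :=
        monotone_nat_of_le_succ fun n => by rw [Finset.sum_range_succ]; linarith [hD j n]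
      exact absurd (h2.trans_le (hm hkl)) (not_lt.2 h3)
    intro k l hkl
    refine measure_mono_null (t := {D | ¬ ∀ b n, 0 < D b n}) ?_ (ae_iff.1 (ae_motionLaw_pos hl))
    rintro D ⟨hk, hl'⟩ hD
    rcases lt_or_gt_of_ne hkl with h | h
    · exact key D hD k l h hk.1 hl'.1
    · exact key D hD l k h hl'.1 hk.1
  obtain ⟨hr0, hr1⟩ := gcp_ratio_mem hl ha
  obtain ⟨hs0, hs1⟩ := gcp_ratio_mem hl hb
  have hrs : lam * a / (1 + lam * a) * (lam * (t - a) / (1 + lam * (t - a))) < 1 := by nlinarith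
  rw [measure_congr h1, measure_iUnion₀ hdisj fun k => (hEm k).nullMeasurableSet]
  have hterm (k : ℕ) : motionLaw lam (E k) = ENNReal.ofReal ((1 - lam * a / (1 + lam * a)) *
      (lam * a / (1 + lam * a) * (lam * (t - a) / (1 + lam * (t - a)))) ^ k) := by
    rw [motionLaw_inter hl j, gcp_count_eq hl ha, gcp_sum_lt hl hb,
      ← ENNReal.ofReal_mul (mul_nonneg (pow_nonneg hr0.le _) (by linarith)), mul_pow]
    congr 1; ring
  simp_rw [hterm]
  rw [← ENNReal.ofReal_tsum_of_nonneg
    (fun k => mul_nonneg (by linarith) (pow_nonneg (mul_pos hr0 hs0).le k))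
    ((summable_geometric_of_lt_one (mul_pos hr0 hs0).le hrs).mul_left _), tsum_mul_left,
    tsum_geometric_of_lt_one (mul_pos hr0 hs0).le hrs, geometric_sum_identity hl ha hb]
  congr 3; ring

theorem phaseTime_nonneg (S : ℕ → ℝ) {t : ℝ} (ht : 0 ≤ t) : 0 ≤ phaseTime S t := by
  have := monotone_phaseTime S ht
  rwa [phaseTime, intervalIntegral.integral_same] at this

theorem phaseTime_le (S : ℕ → ℝ) {t : ℝ} (ht : 0 ≤ t) : phaseTime S t ≤ t := by
  have := intervalIntegral.integral_mono ht (intervalIntegrable_initialPhase S 0 t)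
    intervalIntegrable_const (initialPhase_le_one S)
  simpa [phaseTime] using this

theorem motionLaw_phaseTime_le {lam a t : ℝ} (hl : 0 < lam) (ha : 0 ≤ a) (hat : a < t) (j : Bool) :
    motionLaw lam {D | phaseTime (changeEpoch j D) t ≤ a} =
      ENNReal.ofReal (lam * a / (1 + lam * t)) := by
  have := isProbabilityMeasure_motionLaw hl
  have key : ∀ b, 0 < b → b < t → motionLaw lam {D | phaseTime (changeEpoch j D) t ≤ b} =
      ENNReal.ofReal (lam * b / (1 + lam * t)) := by
    intro b hb hbt
    have hlt : 0 < lam * t := mul_pos hl (hb.trans hbt)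
    have hlb : 0 < lam * (t - b) := mul_pos hl (sub_pos.2 hbt)
    have hm : MeasurableSet {D | b < phaseTime (changeEpoch j D) t} := measurableSet_lt
      measurable_const (measurable_phaseTime_right j t)
    have : {D | phaseTime (changeEpoch j D) t ≤ b} = {D | b < phaseTime (changeEpoch j D) t}ᶜ := by
      ext D; simp
    rw [this, prob_compl_eq_one_sub hm, motionLaw_lt_phaseTime hl hb hbt, ← ENNReal.ofReal_one,
      ← ENNReal.ofReal_sub _ (by positivity)]
    congr 1; field_simp; ring
  rcases ha.eq_or_lt with rfl | ha
  -- The geometric formulas need a positive level; the absence of an atom at `0` follows by letting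
  -- `b` decrease to `0`.
  · rw [mul_zero, zero_div, ENNReal.ofReal_zero]
    have hlim : Tendsto (fun b => ENNReal.ofReal (lam * b / (1 + lam * t))) (𝓝[>] 0) (𝓝 0) := by
      have : Tendsto (fun b => ENNReal.ofReal (lam * b / (1 + lam * t))) (𝓝[>] 0)
          (𝓝 (ENNReal.ofReal (lam * 0 / (1 + lam * t)))) :=
        (ENNReal.tendsto_ofReal (Continuous.tendsto (by fun_prop) 0)).mono_left nhdsWithin_le_nhds
      simpa using this
    refine le_antisymm (ge_of_tendsto hlim ?_) zero_le
    filter_upwards [Ioo_mem_nhdsGT hat] with b hb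
    rw [← key b hb.1 hb.2]
    exact measure_mono fun D (hD : _ ≤ _) => hD.trans hb.1.le
  · exact key a ha hat

/-- The distribution function is linear on `[0, t)` and jumps to `1` at `t`. The atom is the event
that the velocity has not changed up to time `t`. -/
theorem map_phaseTime {lam t : ℝ} (hl : 0 < lam) (ht : 0 < t) (j : Bool) :
    (motionLaw lam).map (fun D => phaseTime (changeEpoch j D) t) =
      ENNReal.ofReal (1 / (1 + lam * t)) • Measure.dirac t +
        ENNReal.ofReal (lam / (1 + lam * t)) • volume.restrict (Ioo 0 t) := by
  have := isProbabilityMeasure_motionLaw hl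
  have hlt : 0 < lam * t := mul_pos hl ht
  have hm := measurable_phaseTime_right j t
  have := Measure.isProbabilityMeasure_map (μ := motionLaw lam) hm.aemeasurable
  refine Measure.ext_of_Iic _ _ fun a => ?_
  rw [Measure.map_apply hm measurableSet_Iic]
  simp only [Measure.coe_add, Measure.coe_smul, Pi.add_apply, Pi.smul_apply, smul_eq_mul,
    Measure.dirac_apply' _ measurableSet_Iic, Measure.restrict_apply measurableSet_Iic]
  rcases lt_or_ge a 0 with ha | ha
  · have h1 : (fun D => phaseTime (changeEpoch j D) t) ⁻¹' Iic a = ∅ := by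
      ext D
      simpa using ha.trans_le (phaseTime_nonneg _ ht.le)
    have h2 : Iic a ∩ Ioo 0 t = ∅ := by
      ext x; simp only [mem_inter_iff, mem_Iic, mem_Ioo, mem_empty_iff_false, iff_false]
      rintro ⟨h1, h2, -⟩; linarith
    have h3 : t ∉ Iic a := by simp; linarith
    simp [h1, h2, h3]
  rcases lt_or_ge a t with hat | hat
  · have h3 : t ∉ Iic a := by simpa using hat
    have h2 : volume (Iic a ∩ Ioo 0 t) = ENNReal.ofReal a := by
      have : Iic a ∩ Ioo 0 t = Ioc 0 a := by
        ext x; simp only [mem_inter_iff, mem_Iic, mem_Ioo, mem_Ioc]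
        exact ⟨fun h => ⟨h.2.1, h.1⟩, fun h => ⟨h.2, h.1, h.2.trans_lt hat⟩⟩
      rw [this, Real.volume_Ioc, sub_zero]
    rw [h2, indicator_of_notMem h3, mul_zero, zero_add, ← ENNReal.ofReal_mul (by positivity)]
    refine (motionLaw_phaseTime_le hl ha hat j).trans ?_
    congr 1; ring
  · have h1 : (fun D => phaseTime (changeEpoch j D) t) ⁻¹' Iic a = univ := by
      ext D
      simpa using (phaseTime_le (changeEpoch j D) ht.le).trans hat
    have h2 : Iic a ∩ Ioo 0 t = Ioo 0 t := inter_eq_right.2 fun x hx => hx.2.le.trans hat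
    rw [h1, h2, measure_univ, indicator_of_mem (by simpa using hat), Real.volume_Ioo, sub_zero,
      Pi.one_apply, mul_one, ← ENNReal.ofReal_mul (by positivity),
      ← ENNReal.ofReal_add (by positivity) (by positivity), ← ENNReal.ofReal_one]
    congr 1; field_simp

theorem lintegral_comp_affine {c d : ℝ} (hc : c ≠ 0) (s : Set ℝ) (hs : MeasurableSet s)
    (φ : ℝ → ℝ≥0∞) :
    ∫⁻ u in s, φ (d + c * u) =
      ENNReal.ofReal |c|⁻¹ * ∫⁻ x in (fun u => d + c * u) '' s, φ x := by
  have hd : ∀ x ∈ s, HasDerivWithinAt (fun u => d + c * u) c s x := fun x _ => by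
    simpa using (((hasDerivAt_id x).const_mul c).const_add d).hasDerivWithinAt
  have hinj : InjOn (fun u => d + c * u) s := fun x _ y _ h => by simpa [hc] using h
  rw [lintegral_image_eq_lintegral_abs_deriv_mul hs hd hinj, lintegral_const_mul' _ _ ENNReal.ofReal_ne_top,
    ← mul_assoc, ← ENNReal.ofReal_mul (by positivity), inv_mul_cancel₀ (abs_ne_zero.2 hc),
    ENNReal.ofReal_one, one_mul]

/-- Swapping the initial velocity only reverses the orientation of the affine map. Hence the
absolutely continuous part of the law of the position does not depend on `j`. -/
theorem image_affine_Ioo {v₁ v₂ t : ℝ} (hv : v₂ < v₁) (j : Bool) :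
    (fun u => velocityOf v₁ v₂ (!j) * t + (velocityOf v₁ v₂ j - velocityOf v₁ v₂ (!j)) * u) ''
      Ioo 0 t = Ioo (v₂ * t) (v₁ * t) := by
  have hd : 0 < v₁ - v₂ := sub_pos.2 hv
  ext x
  constructor
  · rintro ⟨u, ⟨h0, h1⟩, rfl⟩
    have := mul_pos hd h0
    have := mul_pos hd (sub_pos.2 h1)
    cases j <;> simp only [velocityOf, Bool.not_true, Bool.not_false, if_true, if_false,
      Bool.false_eq_true, mem_Ioo] <;> constructor <;> nlinarith
  · rintro ⟨h0, h1⟩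
    cases j
    · refine ⟨(v₁ * t - x) / (v₁ - v₂), ⟨div_pos (by linarith) hd, ?_⟩, ?_⟩
      · rw [div_lt_iff₀ hd]; nlinarith
      · have := hd.ne'
        simp [velocityOf]; field_simp; ring
    · refine ⟨(x - v₂ * t) / (v₁ - v₂), ⟨div_pos (by linarith) hd, ?_⟩, ?_⟩
      · rw [div_lt_iff₀ hd]; nlinarith
      · have := hd.ne'
        simp [velocityOf]; field_simp; ring

/-- The law of the position at time `t` is uniform up to the atom of the unperturbed motion. -/
theorem lintegral_position {v₁ v₂ lam t : ℝ} (hv : v₂ < v₁) (hl : 0 < lam) (ht : 0 ≤ t) (j : Bool)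
    (φ : ℝ → ℝ≥0∞) (hφ : Measurable φ) :
    ∫⁻ D, φ (position v₁ v₂ j D t) ∂(motionLaw lam) =
      ENNReal.ofReal (1 / (1 + lam * t)) * φ (velocityOf v₁ v₂ j * t) +
        ENNReal.ofReal (lam / ((1 + lam * t) * (v₁ - v₂))) *
          ∫⁻ x in Ioo (v₂ * t) (v₁ * t), φ x := by
  have := isProbabilityMeasure_motionLaw hl
  have hd : 0 < v₁ - v₂ := sub_pos.2 hv
  -- At `t = 0` the atom has weight `1` and the open interval is empty.
  rcases ht.eq_or_lt with rfl | ht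
  · simp [position]
  have hm := measurable_phaseTime_right j t
  set c := velocityOf v₁ v₂ j - velocityOf v₁ v₂ (!j) with hc
  have hcabs : |c| = v₁ - v₂ := by
    cases j <;> simp only [hc, velocityOf, Bool.not_true, Bool.not_false, if_true, if_false,
      Bool.false_eq_true]
    · rw [abs_sub_comm, abs_of_pos hd]
    · rw [abs_of_pos hd]
  have hc0 : c ≠ 0 := by rw [← abs_pos, hcabs]; exact hd
  have hψ : Measurable fun u => φ (velocityOf v₁ v₂ (!j) * t + c * u) := by fun_prop
  simp_rw [position_eq]
  rw [← lintegral_map (f := fun u => φ (velocityOf v₁ v₂ (!j) * t + c * u)) hψ hm,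
    map_phaseTime hl ht, lintegral_add_measure, lintegral_smul_measure, lintegral_smul_measure,
    lintegral_dirac' _ hψ, lintegral_comp_affine hc0 _ measurableSet_Ioo, image_affine_Ioo hv,
    smul_eq_mul, smul_eq_mul, ← mul_assoc, ← ENNReal.ofReal_mul (by positivity), hcabs]
  congr 3
  · rw [hc]; ring
  · field_simp

/-! ### The time since the last reset -/

theorem lintegral_pow_div_factorial (m : ℕ) {w : ℝ} (hw : 0 ≤ w) :
    ∫⁻ u in Ioo 0 w, ENNReal.ofReal (u ^ m / m.factorial) =
      ENNReal.ofReal (w ^ (m + 1) / (m + 1).factorial) := by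
  have hi : IntegrableOn (fun u : ℝ => u ^ m / m.factorial) (Ioc 0 w) :=
    (Continuous.integrableOn_Icc (by fun_prop)).mono_set Ioc_subset_Icc_self
  rw [setLIntegral_congr Ioo_ae_eq_Ioc, ← ofReal_integral_eq_lintegral_ofReal hi
    (by filter_upwards [ae_restrict_mem measurableSet_Ioc] with u hu
        exact div_nonneg (pow_nonneg hu.1.le _) (by positivity)),
    ← intervalIntegral.integral_of_le hw, intervalIntegral.integral_div, integral_pow,
    Nat.factorial_succ]
  congr 1
  push_cast
  field_simp
  simp

/-- The epochs of a Poisson process have Erlang distributions. -/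
theorem lintegral_resetEpoch_succ {ξ : ℝ} (hξ : 0 < ξ) (m : ℕ) (g : ℝ → ℝ≥0∞)
    (hg : Measurable g) :
    ∫⁻ R, g (resetEpoch R (m + 1)) ∂(Measure.infinitePi fun _ : ℕ => expMeasure ξ) =
      ∫⁻ u in Ioi 0, ENNReal.ofReal (ξ ^ (m + 1) * (u ^ m / m.factorial) * Real.exp (-(ξ * u))) *
        g u := by
  have := isProbabilityMeasure_expMeasure hξ
  induction m generalizing g with
  | zero =>
    have h := lintegral_sum_range_next (expMeasure ξ) 0 (fun p => g p.2) (by fun_prop)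
    simp only [lintegral_const, measure_univ, mul_one] at h
    simpa [resetEpoch, lintegral_expMeasure g hg] using h
  | succ m ih =>
    have h := lintegral_sum_range_next (expMeasure ξ) (m + 1) (fun p => g (p.1 + p.2)) (by fun_prop)
    have hψ : Measurable fun s => ∫⁻ r, g (s + r) ∂(expMeasure ξ) :=
      Measurable.lintegral_prod_right' (f := fun p : ℝ × ℝ => g (p.1 + p.2)) (by fun_prop)
    have h2 := ih _ hψ
    simp only [resetEpoch] at h2 ⊢
    simp_rw [Finset.sum_range_succ _ (m + 1)]
    rw [h, h2, ← lintegral_indicator measurableSet_Ioi, ← lintegral_indicator measurableSet_Ioi]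
    -- With `w = u + r` the convolution becomes an integral over the triangle `0 < u < w`. The
    -- exponentials merge into `exp (-(ξ * w))`, which leaves only `u ^ m / m!` to be integrated
    -- over `(0, w)` after swapping.
    have h3 : ∀ u : ℝ, (Ioi (0 : ℝ)).indicator (fun u => ENNReal.ofReal
        (ξ ^ (m + 1) * (u ^ m / m.factorial) * Real.exp (-(ξ * u))) *
          ∫⁻ r, g (u + r) ∂(expMeasure ξ)) u =
        ∫⁻ w, {p : ℝ × ℝ | 0 < p.1 ∧ p.1 < p.2}.indicator (fun p =>
          ENNReal.ofReal (p.1 ^ m / m.factorial) *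
            (ENNReal.ofReal (ξ ^ (m + 2) * Real.exp (-(ξ * p.2))) * g p.2)) (u, w) := by
      intro u
      by_cases hu : 0 < u
      · have hm1 : Measurable fun w => (Ioi u).indicator (fun w =>
            ENNReal.ofReal (ξ * Real.exp (-(ξ * (w - u)))) * g w) w :=
          Measurable.indicator (by fun_prop) measurableSet_Ioi
        rw [indicator_of_mem (mem_Ioi.2 hu), lintegral_expMeasure _ (by fun_prop),
          ← lintegral_indicator measurableSet_Ioi]
        have h4 : ∫⁻ r, (Ioi 0).indicator (fun x =>
            ENNReal.ofReal (ξ * Real.exp (-(ξ * x))) * g (u + x)) r =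
            ∫⁻ w, (Ioi u).indicator (fun w =>
              ENNReal.ofReal (ξ * Real.exp (-(ξ * (w - u)))) * g w) w := by
          symm
          rw [← lintegral_add_left_eq_self _ u]
          refine lintegral_congr fun r => ?_
          simp [Set.indicator]
        rw [h4, ← lintegral_const_mul _ hm1]
        refine lintegral_congr fun w => ?_
        by_cases hw : u < w
        · rw [indicator_of_mem (mem_Ioi.2 hw), indicator_of_mem (by exact ⟨hu, hw⟩), ← mul_assoc,
            ← mul_assoc, ← ENNReal.ofReal_mul (by positivity), ← ENNReal.ofReal_mul (by positivity)]
          congr 2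
          have : Real.exp (-(ξ * w)) = Real.exp (-(ξ * u)) * Real.exp (-(ξ * (w - u))) := by
            rw [← Real.exp_add]; ring_nf
          rw [this]; ring
        · rw [indicator_of_notMem (by simpa using hw), indicator_of_notMem (fun h => hw h.2),
            mul_zero]
      · rw [indicator_of_notMem (by simpa using hu)]
        simp [Set.indicator, hu]
    simp_rw [h3]
    have hset : MeasurableSet {p : ℝ × ℝ | 0 < p.1 ∧ p.1 < p.2} :=
      (measurableSet_lt measurable_const measurable_fst).inter
        (measurableSet_lt measurable_fst measurable_snd)
    rw [lintegral_lintegral_swap]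
    · refine lintegral_congr fun w => ?_
      by_cases hw : 0 < w
      · rw [indicator_of_mem (mem_Ioi.2 hw)]
        have h5 : ∀ u, {p : ℝ × ℝ | 0 < p.1 ∧ p.1 < p.2}.indicator (fun p =>
            ENNReal.ofReal (p.1 ^ m / m.factorial) *
              (ENNReal.ofReal (ξ ^ (m + 2) * Real.exp (-(ξ * p.2))) * g p.2)) (u, w) =
            (Ioo 0 w).indicator (fun u => ENNReal.ofReal (u ^ m / m.factorial)) u *
              (ENNReal.ofReal (ξ ^ (m + 2) * Real.exp (-(ξ * w))) * g w) := by
          intro u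
          by_cases hu : u ∈ Ioo 0 w
          · rw [indicator_of_mem hu, indicator_of_mem (by exact hu)]
          · rw [indicator_of_notMem hu, indicator_of_notMem (by exact hu), zero_mul]
        simp_rw [h5]
        rw [lintegral_mul_const _ (Measurable.indicator (by fun_prop) measurableSet_Ioo),
          lintegral_indicator measurableSet_Ioo, lintegral_pow_div_factorial m hw.le, ← mul_assoc,
          ← ENNReal.ofReal_mul (by positivity)]
        congr 2
        ring
      · rw [indicator_of_notMem (by simpa using hw), lintegral_eq_zero_of_ae_eq_zero]
        filter_upwards with u
        exact indicator_of_notMem (fun h => hw (h.1.trans h.2)) _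
    · exact (Measurable.indicator (by fun_prop) hset).aemeasurable

/-- Chernoff bound: the indicator of `∑ R i ≤ a + 1` is at most `exp (a + 1) * exp (-∑ R i)`, whose
mean decays geometrically in `k`. -/
theorem ae_reset_exists_count {ξ a : ℝ} (hξ : 0 < ξ) (ha : 0 ≤ a) :
    ∀ᵐ R ∂(Measure.infinitePi fun _ : ℕ => expMeasure ξ),
      ∃ k, ∑ i ∈ Finset.range k, R i ≤ a ∧ a < ∑ i ∈ Finset.range (k + 1), R i := by
  have := isProbabilityMeasure_expMeasure hξ
  refine ae_exists_count _ ha ?_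
  have hr1 : ξ / (ξ + 1) < 1 := by rw [div_lt_one (by linarith)]; linarith
  have hlim : Tendsto (fun k : ℕ => ENNReal.ofReal (Real.exp (a + 1)) *
      ENNReal.ofReal ((ξ / (ξ + 1)) ^ k)) atTop (𝓝 0) := by
    have := ENNReal.Tendsto.const_mul (a := ENNReal.ofReal (Real.exp (a + 1)))
      (ENNReal.tendsto_ofReal (tendsto_pow_atTop_nhds_zero_of_lt_one (by positivity) hr1))
      (Or.inr ENNReal.ofReal_ne_top)
    simpa using this
  refine tendsto_of_tendsto_of_tendsto_of_le_of_le tendsto_const_nhds hlim (fun _ => zero_le)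
    fun k => ?_
  have hm := measurable_sum_range k
  have hms : MeasurableSet {R : ℕ → ℝ | ∑ i ∈ Finset.range k, R i ≤ a + 1} :=
    measurableSet_le hm measurable_const
  change _ ≤ _ * _
  rw [← laplace_sum_range hξ zero_le_one k, ← lintegral_const_mul _ (by fun_prop),
    ← lintegral_indicator_one hms]
  refine lintegral_mono fun R => ?_
  by_cases hR : ∑ i ∈ Finset.range k, R i ≤ a + 1
  · rw [indicator_of_mem (by exact hR), ← ENNReal.ofReal_mul (by positivity), ← Real.exp_add,
      Pi.one_apply, ← ENNReal.ofReal_one]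
    exact ENNReal.ofReal_le_ofReal (Real.one_le_exp (by linarith))
  · rw [indicator_of_notMem (by exact hR)]; exact zero_le

/-- The renewal density of a Poisson process is the constant `ξ`: the Erlang densities add up to an
exponential series. -/
theorem tsum_erlang {ξ u : ℝ} (hξ : 0 < ξ) (hu : 0 < u) :
    ∑' m : ℕ, ENNReal.ofReal (ξ ^ (m + 1) * (u ^ m / m.factorial) * Real.exp (-(ξ * u))) =
      ENNReal.ofReal ξ := by
  have h : HasSum (fun m : ℕ => ξ ^ (m + 1) * (u ^ m / m.factorial) * Real.exp (-(ξ * u))) ξ := by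
    have h1 := (NormedSpace.expSeries_div_hasSum_exp (ξ * u)).mul_left (ξ * Real.exp (-(ξ * u)))
    rw [← Real.exp_eq_exp_ℝ, mul_assoc, ← Real.exp_add, neg_add_cancel, Real.exp_zero, mul_one] at h1
    refine h1.congr_fun fun m => ?_
    rw [mul_pow]; ring
  rw [← ENNReal.ofReal_tsum_of_nonneg (fun m => by positivity) h.summable, h.tsum_eq]

/-- The time since the last reset is exponential, truncated at `t`. -/
theorem lintegral_age {ξ t : ℝ} (hξ : 0 < ξ) (ht : 0 ≤ t) (φ : ℝ → ℝ≥0∞) (hφ : Measurable φ) :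
    ∫⁻ R, φ (t - resetEpoch R (countEpochs (resetEpoch R) t))
      ∂(Measure.infinitePi fun _ : ℕ => expMeasure ξ) =
    ENNReal.ofReal (Real.exp (-(ξ * t))) * φ t +
      ∫⁻ s in Ioo 0 t, ENNReal.ofReal (ξ * Real.exp (-(ξ * s))) * φ s := by
  have := isProbabilityMeasure_expMeasure hξ
  -- `F` at the `m`-th reset epoch and the next waiting time is the contribution of the event that
  -- reset `m` is the last one before `t`; almost surely exactly one `m` satisfies this. Integrating
  -- out the waiting time yields `g`.
  set F : ℝ × ℝ → ℝ≥0∞ := {p : ℝ × ℝ | p.1 ≤ t ∧ t < p.1 + p.2}.indicator (fun p => φ (t - p.1))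
    with hF
  have hset : MeasurableSet {p : ℝ × ℝ | p.1 ≤ t ∧ t < p.1 + p.2} :=
    (measurableSet_le measurable_fst measurable_const).inter
      (measurableSet_lt measurable_const (measurable_fst.add measurable_snd))
  have hFm : Measurable F := Measurable.indicator (by fun_prop) hset
  set g : ℝ → ℝ≥0∞ := (Iic t).indicator (fun s =>
    ENNReal.ofReal (Real.exp (-(ξ * (t - s)))) * φ (t - s)) with hgdef
  have hg : Measurable g := Measurable.indicator (by fun_prop) measurableSet_Iic
  have hFg : ∀ s, ∫⁻ r, F (s, r) ∂(expMeasure ξ) = g s := by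
    intro s
    by_cases hs : s ≤ t
    · have h1 : ∀ r, F (s, r) = (Ioi (t - s)).indicator (fun _ => φ (t - s)) r := by
        intro r
        have : (t < s + r) ↔ (t - s < r) := by constructor <;> intro <;> linarith
        simp [hF, Set.indicator, hs, this]
      simp_rw [h1]
      rw [lintegral_indicator_const measurableSet_Ioi, expMeasure_Ioi hξ (sub_nonneg.2 hs), hgdef,
        indicator_of_mem (mem_Iic.2 hs), mul_comm]
    · simp [hF, hgdef, hs]
  have h1 : ∀ᵐ R ∂(Measure.infinitePi fun _ : ℕ => expMeasure ξ),
      φ (t - resetEpoch R (countEpochs (resetEpoch R) t)) =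
        ∑' m, F (∑ i ∈ Finset.range m, R i, R m) := by
    filter_upwards [ae_reset_exists_count hξ ht, ae_infinitePi_forall _ (ae_expMeasure_pos hξ)]
      with R ⟨k, hk1, hk2⟩ hR
    have hmono : Monotone (resetEpoch R) := monotone_nat_of_le_succ fun n => by
      rw [resetEpoch, resetEpoch, Finset.sum_range_succ]; linarith [hR n]
    rw [countEpochs_eq hmono hk1 hk2, tsum_eq_single k]
    · rw [hF, indicator_of_mem]
      · rfl
      · rw [Finset.sum_range_succ] at hk2
        exact ⟨hk1, hk2⟩
    · intro m hm
      rw [hF, indicator_of_notMem]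
      rintro ⟨h1, h2⟩
      refine hm ?_
      have h2' : t < resetEpoch R (m + 1) := by
        rw [resetEpoch, Finset.sum_range_succ]; exact h2
      rw [← countEpochs_eq hmono (n := m) h1 h2', countEpochs_eq hmono hk1 hk2]
  have hterm : ∀ m, ∫⁻ R, F (∑ i ∈ Finset.range m, R i, R m)
      ∂(Measure.infinitePi fun _ : ℕ => expMeasure ξ) =
      ∫⁻ R, g (resetEpoch R m) ∂(Measure.infinitePi fun _ : ℕ => expMeasure ξ) := by
    intro m
    rw [lintegral_sum_range_next _ _ _ hFm]
    simp_rw [hFg]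
    rfl
  have hFc (m : ℕ) : Measurable fun R : ℕ → ℝ => F (∑ i ∈ Finset.range m, R i, R m) :=
    hFm.comp ((measurable_sum_range m).prodMk (measurable_pi_apply m))
  rw [lintegral_congr_ae h1, lintegral_tsum fun m => (hFc m).aemeasurable]
  simp_rw [hterm]
  -- The term `m = 0` means no reset and gives the atom of the age at `t`; the other terms sum to
  -- the constant renewal density.
  rw [tsum_eq_zero_add' ENNReal.summable]
  congr 1
  · simp [resetEpoch, hgdef, ht]
  · simp_rw [lintegral_resetEpoch_succ hξ _ g hg]
    rw [← lintegral_tsum fun m => by fun_prop]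
    simp_rw [ENNReal.tsum_mul_right]
    have h2 : ∫⁻ u in Ioi (0 : ℝ), (∑' m : ℕ, ENNReal.ofReal
        (ξ ^ (m + 1) * (u ^ m / m.factorial) * Real.exp (-(ξ * u)))) * g u =
        ∫⁻ u in Ioi (0 : ℝ), ENNReal.ofReal ξ * g u :=
      setLIntegral_congr_fun measurableSet_Ioi fun u hu => by
        rw [tsum_erlang hξ hu]
    have h3 : ∀ u, ENNReal.ofReal ξ * g u = (Iic t).indicator (fun s =>
        ENNReal.ofReal (ξ * Real.exp (-(ξ * (t - s)))) * φ (t - s)) u := by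
      intro u
      by_cases hu : u ≤ t
      · rw [hgdef, indicator_of_mem (mem_Iic.2 hu), indicator_of_mem (mem_Iic.2 hu), ← mul_assoc,
          ← ENNReal.ofReal_mul hξ.le]
      · simp [hgdef, Set.indicator, hu]
    rw [h2]
    simp_rw [h3]
    rw [lintegral_indicator measurableSet_Iic, Measure.restrict_restrict measurableSet_Iic,
      inter_comm, Ioi_inter_Iic, setLIntegral_congr Ioo_ae_eq_Ioc.symm]
    have h4 := lintegral_comp_affine (c := -1) (d := t) (by norm_num) (Ioo 0 t) measurableSet_Ioo
      (fun s => ENNReal.ofReal (ξ * Real.exp (-(ξ * s))) * φ s)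
    have h5 : (fun u : ℝ => t + -1 * u) '' Ioo 0 t = Ioo 0 t := by
      ext x
      simp only [mem_image, mem_Ioo]
      exact ⟨by rintro ⟨u, hu, rfl⟩; constructor <;> linarith,
        fun h => ⟨t - x, ⟨by linarith, by linarith⟩, by ring⟩⟩
    rw [h5] at h4
    simpa [neg_one_mul, ← sub_eq_add_neg] using h4

/-! ### The laws of the position with and without resets -/

theorem measurable_resetEpoch : Measurable resetEpoch :=
  measurable_pi_lambda _ fun m => measurable_sum_range m

theorem measurable_resetCount (t : ℝ) :
    Measurable fun R : ℕ → ℝ => countEpochs (resetEpoch R) t := by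
  have h := Measurable.comp measurable_countEpochs (measurable_resetEpoch.prodMk
    (measurable_const (a := t)))
  simpa only [Function.comp_def] using h

theorem measurable_lastReset (t : ℝ) :
    Measurable fun R : ℕ → ℝ => resetEpoch R (countEpochs (resetEpoch R) t) := by
  have h : Measurable fun p : ℕ × (ℕ → ℝ) => resetEpoch p.2 p.1 :=
    measurable_from_prod_countable_right fun m => measurable_sum_range m
  have h2 := Measurable.comp h ((measurable_resetCount t).prodMk measurable_id)
  simpa only [Function.comp_def, id_eq] using h2

theorem measurable_resetPosition_right (v₁ v₂ t : ℝ) (j : Bool) :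
    Measurable fun p : (ℕ → ℝ) × (ℕ → Bool → ℕ → ℝ) => resetPosition v₁ v₂ t (j, p) := by
  have h1 : Measurable fun p : ℕ × (ℕ → Bool → ℕ → ℝ) => p.2 p.1 :=
    measurable_from_prod_countable_right fun m => measurable_pi_apply m
  have hf : Measurable (Prod.fst : (ℕ → ℝ) × (ℕ → Bool → ℕ → ℝ) → _) := measurable_fst
  have hs : Measurable (Prod.snd : (ℕ → ℝ) × (ℕ → Bool → ℕ → ℝ) → _) := measurable_snd
  have h2 := Measurable.comp h1 (((measurable_resetCount t).comp hf).prodMk hs)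
  have h3 := (measurable_const (a := t)).sub ((measurable_lastReset t).comp hf)
  have h4 := Measurable.comp (measurable_position v₁ v₂ j) (h2.prodMk h3)
  simpa only [Function.comp_def, resetPosition, Pi.sub_apply] using h4

theorem measurable_resetPosition (v₁ v₂ t : ℝ) : Measurable (resetPosition v₁ v₂ t) :=
  measurable_from_prod_countable_right (measurable_resetPosition_right v₁ v₂ t)

theorem measurable_position_left (v₁ v₂ t : ℝ) (j : Bool) :
    Measurable fun D : Bool → ℕ → ℝ => position v₁ v₂ j D t := by
  have h := Measurable.comp (measurable_position v₁ v₂ j)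
    (measurable_prodMk_right (y := t) : Measurable fun D : Bool → ℕ → ℝ => (D, t))
  simpa only [Function.comp_def] using h

theorem measurable_freePosition_right (v₁ v₂ t : ℝ) (j : Bool) :
    Measurable fun p : (ℕ → ℝ) × (ℕ → Bool → ℕ → ℝ) => freePosition v₁ v₂ t (j, p) := by
  have hs : Measurable (Prod.snd : (ℕ → ℝ) × (ℕ → Bool → ℕ → ℝ) → _) := measurable_snd
  have h := Measurable.comp (measurable_position_left v₁ v₂ t j) ((measurable_pi_apply 0).comp hs)
  simpa only [Function.comp_def, freePosition] using h

theorem measurable_freePosition (v₁ v₂ t : ℝ) : Measurable (freePosition v₁ v₂ t) :=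
  measurable_from_prod_countable_right (measurable_freePosition_right v₁ v₂ t)

/-- The integral of `φ` against the law of the position at time `t` without resets. -/
noncomputable def positionIntegral (v₁ v₂ lam : ℝ) (j : Bool) (φ : ℝ → ℝ≥0∞) (t : ℝ) : ℝ≥0∞ :=
  ENNReal.ofReal (1 / (1 + lam * t)) * φ (velocityOf v₁ v₂ j * t) +
    ENNReal.ofReal (lam / ((1 + lam * t) * (v₁ - v₂))) * ∫⁻ x in Ioo (v₂ * t) (v₁ * t), φ x

theorem measurableSet_cone (v₁ v₂ : ℝ) :
    MeasurableSet {p : ℝ × ℝ | p.2 ∈ Ioo (v₂ * p.1) (v₁ * p.1)} :=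
  (measurableSet_lt (measurable_fst.const_mul v₂) measurable_snd).inter
    (measurableSet_lt measurable_snd (measurable_fst.const_mul v₁))

theorem measurable_setLIntegral_cone (v₁ v₂ : ℝ) (φ : ℝ → ℝ≥0∞) (hφ : Measurable φ) :
    Measurable fun s => ∫⁻ x in Ioo (v₂ * s) (v₁ * s), φ x := by
  have h : Measurable fun s => ∫⁻ x, {p : ℝ × ℝ | p.2 ∈ Ioo (v₂ * p.1) (v₁ * p.1)}.indicator
      (fun p => φ p.2) (s, x) :=
    ((hφ.comp measurable_snd).indicator (measurableSet_cone v₁ v₂)).lintegral_prod_right'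
  convert! h using 2 with s
  rw [← lintegral_indicator measurableSet_Ioo]
  rfl

theorem measurable_positionIntegral (v₁ v₂ lam : ℝ) (j : Bool) (φ : ℝ → ℝ≥0∞)
    (hφ : Measurable φ) : Measurable (positionIntegral v₁ v₂ lam j φ) := by
  have := measurable_setLIntegral_cone v₁ v₂ φ hφ
  unfold positionIntegral
  fun_prop

theorem lintegral_sampleLaw {q ξ lam : ℝ} (hξ : 0 < ξ) (hl : 0 < lam)
    (Φ : Sample → ℝ≥0∞) (hΦ : Measurable Φ) :
    ∫⁻ ω, Φ ω ∂(sampleLaw q ξ lam) =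
      ENNReal.ofReal q * ∫⁻ R, ∫⁻ D, Φ (true, R, D) ∂(Measure.infinitePi fun _ : ℕ => motionLaw lam)
        ∂(Measure.infinitePi fun _ : ℕ => expMeasure ξ) +
      ENNReal.ofReal (1 - q) * ∫⁻ R, ∫⁻ D, Φ (false, R, D)
        ∂(Measure.infinitePi fun _ : ℕ => motionLaw lam)
        ∂(Measure.infinitePi fun _ : ℕ => expMeasure ξ) := by
  have := isProbabilityMeasure_expMeasure hξ
  have := isProbabilityMeasure_motionLaw hl
  have h1 : sampleLaw q ξ lam = (initialLaw q).prod
      ((Measure.infinitePi fun _ : ℕ => expMeasure ξ).prod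
        (Measure.infinitePi fun _ : ℕ => motionLaw lam)) := rfl
  have h2 (j : Bool) : Measurable fun p => Φ (j, p) := hΦ.comp measurable_prodMk_left
  rw [h1, lintegral_prod _ hΦ.aemeasurable, initialLaw, lintegral_add_measure,
    lintegral_smul_measure, lintegral_smul_measure, lintegral_dirac, lintegral_dirac,
    lintegral_prod _ (h2 true).aemeasurable, lintegral_prod _ (h2 false).aemeasurable]
  rfl

theorem lintegral_position_eval {v₁ v₂ lam t : ℝ} (hv : v₂ < v₁) (hl : 0 < lam) (ht : 0 ≤ t)
    (j : Bool) (φ : ℝ → ℝ≥0∞) (hφ : Measurable φ) (n : ℕ) :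
    ∫⁻ D, φ (position v₁ v₂ j (D n) t) ∂(Measure.infinitePi fun _ : ℕ => motionLaw lam) =
      positionIntegral v₁ v₂ lam j φ t := by
  have := isProbabilityMeasure_motionLaw hl
  have h := lintegral_map (μ := Measure.infinitePi fun _ : ℕ => motionLaw lam)
    (hφ.comp (measurable_position_left v₁ v₂ t j)) (measurable_pi_apply n)
  rw [Measure.infinitePi_map_eval (μ := fun _ : ℕ => motionLaw lam) n] at h
  exact h.symm.trans (lintegral_position hv hl ht j φ hφ)

theorem lintegral_freeLaw {v₁ v₂ q lam t : ℝ} (hv : v₂ < v₁) (hl : 0 < lam) (ht : 0 ≤ t)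
    (φ : ℝ → ℝ≥0∞) (hφ : Measurable φ) :
    ∫⁻ x, φ x ∂(freeLaw v₁ v₂ q lam t) =
      ENNReal.ofReal q * positionIntegral v₁ v₂ lam true φ t +
        ENNReal.ofReal (1 - q) * positionIntegral v₁ v₂ lam false φ t := by
  have := isProbabilityMeasure_expMeasure one_pos
  have hm := measurable_freePosition v₁ v₂ t
  rw [freeLaw, lintegral_map hφ hm,
    lintegral_sampleLaw one_pos hl (fun ω => φ (freePosition v₁ v₂ t ω)) (hφ.comp hm)]
  have h (j : Bool) : ∀ R : ℕ → ℝ, ∫⁻ D, φ (freePosition v₁ v₂ t (j, R, D))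
      ∂(Measure.infinitePi fun _ : ℕ => motionLaw lam) = positionIntegral v₁ v₂ lam j φ t :=
    fun R => lintegral_position_eval hv hl ht j φ hφ 0
  simp only [h, lintegral_const, measure_univ, mul_one]

theorem lintegral_resetLaw {v₁ v₂ q ξ lam t : ℝ} (hv : v₂ < v₁) (hξ : 0 < ξ) (hl : 0 < lam)
    (ht : 0 ≤ t) (φ : ℝ → ℝ≥0∞) (hφ : Measurable φ) :
    ∫⁻ x, φ x ∂(resetLaw v₁ v₂ q ξ lam t) =
      ENNReal.ofReal q * (ENNReal.ofReal (Real.exp (-(ξ * t))) * positionIntegral v₁ v₂ lam true φ t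
        + ∫⁻ s in Ioo 0 t, ENNReal.ofReal (ξ * Real.exp (-(ξ * s))) *
          positionIntegral v₁ v₂ lam true φ s) +
      ENNReal.ofReal (1 - q) * (ENNReal.ofReal (Real.exp (-(ξ * t))) *
        positionIntegral v₁ v₂ lam false φ t
        + ∫⁻ s in Ioo 0 t, ENNReal.ofReal (ξ * Real.exp (-(ξ * s))) *
          positionIntegral v₁ v₂ lam false φ s) := by
  have := isProbabilityMeasure_expMeasure hξ
  have hm := measurable_resetPosition v₁ v₂ t
  rw [resetLaw, lintegral_map hφ hm,
    lintegral_sampleLaw hξ hl (fun ω => φ (resetPosition v₁ v₂ t ω)) (hφ.comp hm)]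
  have h (j : Bool) : ∫⁻ R, ∫⁻ D, φ (resetPosition v₁ v₂ t (j, R, D))
      ∂(Measure.infinitePi fun _ : ℕ => motionLaw lam)
      ∂(Measure.infinitePi fun _ : ℕ => expMeasure ξ) =
      ENNReal.ofReal (Real.exp (-(ξ * t))) * positionIntegral v₁ v₂ lam j φ t
        + ∫⁻ s in Ioo 0 t, ENNReal.ofReal (ξ * Real.exp (-(ξ * s))) *
          positionIntegral v₁ v₂ lam j φ s := by
    -- For fixed resets with `k` the last index, the motion in use is the `k`-th independent copy at
    -- a deterministic age, so `lintegral_position_eval` applies before the age is averaged.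
    rw [← lintegral_age hξ ht _ (measurable_positionIntegral v₁ v₂ lam j φ hφ)]
    refine lintegral_congr_ae ?_
    filter_upwards [ae_reset_exists_count hξ ht, ae_infinitePi_forall _ (ae_expMeasure_pos hξ)]
      with R ⟨k, hk1, hk2⟩ hR
    have hmono : Monotone (resetEpoch R) := monotone_nat_of_le_succ fun n => by
      rw [resetEpoch, resetEpoch, Finset.sum_range_succ]; linarith [hR n]
    simp only [resetPosition]
    rw [countEpochs_eq hmono hk1 hk2]
    exact lintegral_position_eval hv hl (sub_nonneg.2 hk1) j φ hφ k
  rw [h true, h false]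

/-! ### Pointwise derivatives of measures with piecewise continuous densities -/

/-- Means over shrinking sets inherit the limit of `f`. The argument compares orders because `L` may
be infinite. -/
theorem tendsto_lintegral_div {f : ℝ → ℝ≥0∞} {l : Filter ℝ} {L : ℝ≥0∞} (hf : Tendsto f l (𝓝 L))
    {s : ℝ → Set ℝ} (hm : ∀ h, MeasurableSet (s h)) (hvol : ∀ h, volume (s h) = ENNReal.ofReal h)
    (hs : ∀ V ∈ l, ∀ᶠ h in 𝓝[>] (0 : ℝ), s h ⊆ V) :
    Tendsto (fun h => (∫⁻ y in s h, f y) / ENNReal.ofReal h) (𝓝[>] 0) (𝓝 L) := by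
  refine tendsto_order.2 ⟨fun a ha => ?_, fun a ha => ?_⟩
  · obtain ⟨b, hab, hb⟩ := exists_between ha
    filter_upwards [hs _ (hf (Ioi_mem_nhds hb)), self_mem_nhdsWithin] with h hsub (hh : 0 < h)
    refine hab.trans_le ?_
    rw [ENNReal.le_div_iff_mul_le (Or.inl (by simpa using hh)) (Or.inl ENNReal.ofReal_ne_top),
      ← hvol h, ← setLIntegral_const]
    exact setLIntegral_mono' (hm h) fun y hy => (hsub hy).le
  · obtain ⟨b, hb, hab⟩ := exists_between ha
    filter_upwards [hs _ (hf (Iio_mem_nhds hb)), self_mem_nhdsWithin] with h hsub (hh : 0 < h)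
    refine lt_of_le_of_lt ?_ hab
    rw [ENNReal.div_le_iff_le_mul (Or.inl (by simpa using hh)) (Or.inl ENNReal.ofReal_ne_top),
      ← hvol h, ← setLIntegral_const]
    exact setLIntegral_mono' (hm h) fun y hy => (hsub hy).le

/-- `f` has one-sided limits at `x`, and `f x` is their mean. -/
def IsAveragedAt (f : ℝ → ℝ≥0∞) (x : ℝ) : Prop :=
  ∃ L R, Tendsto f (𝓝[<] x) (𝓝 L) ∧ Tendsto f (𝓝[>] x) (𝓝 R) ∧ f x = (L + R) / 2

theorem IsAveragedAt.add {f g : ℝ → ℝ≥0∞} {x : ℝ} (hf : IsAveragedAt f x)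
    (hg : IsAveragedAt g x) : IsAveragedAt (fun y => f y + g y) x := by
  obtain ⟨L, R, h1, h2, h3⟩ := hf
  obtain ⟨L', R', h1', h2', h3'⟩ := hg
  refine ⟨L + L', R + R', h1.add h1', h2.add h2', ?_⟩
  change f x + g x = _
  rw [h3, h3', ENNReal.div_add_div_same]
  congr 1; ring

theorem IsAveragedAt.const_mul {f : ℝ → ℝ≥0∞} {x : ℝ} (hf : IsAveragedAt f x) {c : ℝ≥0∞}
    (hc : c ≠ ∞) : IsAveragedAt (fun y => c * f y) x := by
  obtain ⟨L, R, h1, h2, h3⟩ := hf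
  refine ⟨c * L, c * R, ENNReal.Tendsto.const_mul h1 (Or.inr hc),
    ENNReal.Tendsto.const_mul h2 (Or.inr hc), ?_⟩
  change c * f x = _
  rw [h3, ← mul_add, mul_div_assoc]

theorem IsAveragedAt.of_continuousAt {f : ℝ → ℝ≥0∞} {x : ℝ} (hf : ContinuousAt f x) :
    IsAveragedAt f x := by
  refine ⟨f x, f x, hf.mono_left nhdsWithin_le_nhds, hf.mono_left nhdsWithin_le_nhds, ?_⟩
  rw [ENNReal.add_div, ENNReal.add_halves]

theorem IsAveragedAt.comp_div {f : ℝ → ℝ≥0∞} {x v : ℝ} (hv : v ≠ 0)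
    (hf : IsAveragedAt f (x / v)) : IsAveragedAt (fun y => f (y / v)) x := by
  obtain ⟨L, R, h1, h2, h3⟩ := hf
  have hc : Tendsto (fun y => y / v) (𝓝 x) (𝓝 (x / v)) := tendsto_id.div_const v
  rcases lt_or_gt_of_ne hv with hv | hv
  · refine ⟨R, L, h2.comp ?_, h1.comp ?_, by rw [add_comm]; exact h3⟩
    · refine tendsto_nhdsWithin_iff.2 ⟨hc.mono_left nhdsWithin_le_nhds, ?_⟩
      filter_upwards [self_mem_nhdsWithin] with y hy using div_lt_div_of_neg_of_lt hv hy
    · refine tendsto_nhdsWithin_iff.2 ⟨hc.mono_left nhdsWithin_le_nhds, ?_⟩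
      filter_upwards [self_mem_nhdsWithin] with y hy using div_lt_div_of_neg_of_lt hv hy
  · refine ⟨L, R, h1.comp ?_, h2.comp ?_, h3⟩
    · refine tendsto_nhdsWithin_iff.2 ⟨hc.mono_left nhdsWithin_le_nhds, ?_⟩
      filter_upwards [self_mem_nhdsWithin] with y hy using div_lt_div_of_pos_right hy hv
    · refine tendsto_nhdsWithin_iff.2 ⟨hc.mono_left nhdsWithin_le_nhds, ?_⟩
      filter_upwards [self_mem_nhdsWithin] with y hy using div_lt_div_of_pos_right hy hv

/-- Cutting the symmetric interval at `x`, each half contributes half of its one-sided limit; a jump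
at `x` is therefore harmless when `f x` is the midpoint. -/
theorem IsAveragedAt.hasDensityAt {μ : Measure ℝ} {U : Set ℝ} {f : ℝ → ℝ≥0∞} {x : ℝ}
    (hf : IsAveragedAt f x) (hU : IsOpen U) (hx : x ∈ U)
    (hμ : μ.restrict U = (volume.withDensity f).restrict U) : HasDensityAt μ x (f x) := by
  obtain ⟨L, R, h1, h2, h3⟩ := hf
  have hleft : Tendsto (fun h => (∫⁻ y in Ioo (x - h) x, f y) / ENNReal.ofReal h) (𝓝[>] 0)
      (𝓝 L) := by
    refine tendsto_lintegral_div h1 (fun h => measurableSet_Ioo)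
      (fun h => by rw [Real.volume_Ioo]; congr 1; ring) fun V hV => ?_
    obtain ⟨l, hl, hlV⟩ := (mem_nhdsLT_iff_exists_Ioo_subset (a := x)).1 hV
    filter_upwards [Ioo_mem_nhdsGT (sub_pos.2 (show l < x from hl))] with h hh
    exact (Ioo_subset_Ioo_left (by linarith [hh.2])).trans hlV
  have hright : Tendsto (fun h => (∫⁻ y in Ioo x (x + h), f y) / ENNReal.ofReal h) (𝓝[>] 0)
      (𝓝 R) := by
    refine tendsto_lintegral_div h2 (fun h => measurableSet_Ioo)
      (fun h => by rw [Real.volume_Ioo]; congr 1; ring) fun V hV => ?_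
    obtain ⟨l, hl, hlV⟩ := (mem_nhdsGT_iff_exists_Ioo_subset (a := x)).1 hV
    filter_upwards [Ioo_mem_nhdsGT (sub_pos.2 (show x < l from hl))] with h hh
    exact (Ioo_subset_Ioo_right (by linarith [hh.2])).trans hlV
  have hsum := ENNReal.Tendsto.div_const (hleft.add hright) (b := 2) (Or.inr two_ne_zero)
  rw [HasDensityAt, h3]
  refine hsum.congr' ?_
  obtain ⟨ε, hε, hball⟩ := Metric.isOpen_iff.1 hU x hx
  filter_upwards [Ioo_mem_nhdsGT hε] with h ⟨hh, hhε⟩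
  have hsub : Ioo (x - h) (x + h) ⊆ U := by
    rw [← Real.ball_eq_Ioo]
    exact (Metric.ball_subset_ball hhε.le).trans hball
  have h4 : μ (Ioo (x - h) (x + h)) = ∫⁻ y in Ioo (x - h) (x + h), f y := by
    rw [← Measure.restrict_eq_self μ hsub, hμ, Measure.restrict_eq_self _ hsub,
      withDensity_apply _ measurableSet_Ioo]
  have h5 : ∫⁻ y in Ioo (x - h) (x + h), f y =
      (∫⁻ y in Ioo (x - h) x, f y) + ∫⁻ y in Ioo x (x + h), f y := by
    rw [← Ioc_union_Ioo_eq_Ioo (show x - h ≤ x by linarith) (show x < x + h by linarith),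
      lintegral_union measurableSet_Ioo (disjoint_left.2 fun y hy hy' => not_lt.2 hy.2 hy'.1),
      setLIntegral_congr Ioo_ae_eq_Ioc.symm]
  rw [h4, h5, ENNReal.div_add_div_same, ENNReal.ofReal_mul zero_le_two, ENNReal.ofReal_ofNat,
    div_eq_mul_inv, div_eq_mul_inv, div_eq_mul_inv, mul_assoc,
    ENNReal.mul_inv (Or.inl two_ne_zero) (Or.inl ENNReal.ofNat_ne_top), mul_comm (2 : ℝ≥0∞)⁻¹]

theorem restrict_eq_withDensity_restrict {μ : Measure ℝ} {U : Set ℝ} (hU : MeasurableSet U)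
    {f : ℝ → ℝ≥0∞} (h : ∀ B, MeasurableSet B → B ⊆ U →
      ∫⁻ x, B.indicator 1 x ∂μ = ∫⁻ x, f x * B.indicator 1 x) :
    μ.restrict U = (volume.withDensity f).restrict U := by
  ext A hA
  have hB := hA.inter hU
  rw [Measure.restrict_apply hA, Measure.restrict_apply hA, withDensity_apply _ hB,
    ← lintegral_indicator_one hB, h _ hB inter_subset_right, ← lintegral_indicator hB]
  refine lintegral_congr fun x => ?_
  by_cases hx : x ∈ A ∩ U <;> simp [hx]

theorem isDensityOn_of_isAveragedAt {f : ℝ → ℝ≥0∞} (hf : Measurable f) {μ : Measure ℝ} {U : Set ℝ}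
    (hU : IsOpen U) (hav : ∀ x ∈ U, IsAveragedAt f x)
    (h : ∀ B, MeasurableSet B → B ⊆ U →
      ∫⁻ x, B.indicator 1 x ∂μ = ∫⁻ x, f x * B.indicator 1 x) : IsDensityOn μ U f :=
  have hres := restrict_eq_withDensity_restrict hU.measurableSet h
  ⟨hf, hres, fun x hx => (hav x hx).hasDensityAt hU hx hres⟩

/-! ### The density of the position with resets -/

/-- The contribution of the absolutely continuous part of the motion since the last reset. -/
noncomputable def coneDensity (v₁ v₂ ξ lam t x : ℝ) : ℝ≥0∞ :=
  ∫⁻ s in Ioo 0 t, ENNReal.ofReal (ξ * Real.exp (-(ξ * s))) *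
    (ENNReal.ofReal (lam / ((1 + lam * s) * (v₁ - v₂))) * (Ioo (v₂ * s) (v₁ * s)).indicator 1 x)

/-- The density of the time since the last reset on the event that the velocity has not changed
since then. -/
noncomputable def unperturbedAgeDensity (ξ lam t y : ℝ) : ℝ≥0∞ :=
  -- The midpoint of the one-sided limits `0` and `ξ`. It is what the symmetric derivative sees at
  -- the position `0`, which belongs to `densityDomain` when `v₂ < 0`.
  if y = 0 then ENNReal.ofReal ξ / 2 else
    (Ioo 0 t).indicator
      (fun s => ENNReal.ofReal (ξ * Real.exp (-(ξ * s))) * ENNReal.ofReal (1 / (1 + lam * s))) y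

/-- The density of the position with resets. -/
noncomputable def resetDensity (v₁ v₂ q ξ lam t x : ℝ) : ℝ≥0∞ :=
  ENNReal.ofReal (Real.exp (-(ξ * t))) * (ENNReal.ofReal (lam / ((1 + lam * t) * (v₁ - v₂))) *
      (Ioo (v₂ * t) (v₁ * t)).indicator 1 x) +
    coneDensity v₁ v₂ ξ lam t x +
    ENNReal.ofReal q * (ENNReal.ofReal |v₁|⁻¹ * unperturbedAgeDensity ξ lam t (x / v₁)) +
    ENNReal.ofReal (1 - q) * (ENNReal.ofReal |v₂|⁻¹ * unperturbedAgeDensity ξ lam t (x / v₂))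

theorem measurable_coneIntegrand (v₁ v₂ ξ lam : ℝ) : Measurable fun p : ℝ × ℝ =>
    ENNReal.ofReal (ξ * Real.exp (-(ξ * p.1))) * (ENNReal.ofReal (lam / ((1 + lam * p.1) *
      (v₁ - v₂))) * (Ioo (v₂ * p.1) (v₁ * p.1)).indicator 1 p.2) := by
  have h : Measurable fun p : ℝ × ℝ =>
      (Ioo (v₂ * p.1) (v₁ * p.1)).indicator (1 : ℝ → ℝ≥0∞) p.2 := by
    have h1 : Measurable fun _ : ℝ × ℝ => (1 : ℝ≥0∞) := measurable_const
    exact h1.indicator (measurableSet_cone v₁ v₂)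
  fun_prop

theorem measurable_coneDensity (v₁ v₂ ξ lam t : ℝ) : Measurable (coneDensity v₁ v₂ ξ lam t) :=
  (measurable_coneIntegrand v₁ v₂ ξ lam).lintegral_prod_left'

theorem measurable_unperturbedAgeDensity (ξ lam t : ℝ) :
    Measurable (unperturbedAgeDensity ξ lam t) :=
  Measurable.ite (measurableSet_singleton 0) measurable_const
    (Measurable.indicator (by fun_prop) measurableSet_Ioo)

theorem measurable_resetDensity (v₁ v₂ q ξ lam t : ℝ) :
    Measurable (resetDensity v₁ v₂ q ξ lam t) := by
  have h1 := measurable_coneDensity v₁ v₂ ξ lam t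
  have h2 := measurable_unperturbedAgeDensity ξ lam t
  have h3 : Measurable ((Ioo (v₂ * t) (v₁ * t)).indicator (1 : ℝ → ℝ≥0∞)) :=
    measurable_one.indicator measurableSet_Ioo
  unfold resetDensity
  fun_prop

theorem lintegral_coneDensity_mul (v₁ v₂ ξ lam t : ℝ) (φ : ℝ → ℝ≥0∞) (hφ : Measurable φ) :
    ∫⁻ x, coneDensity v₁ v₂ ξ lam t x * φ x =
      ∫⁻ s in Ioo 0 t, ENNReal.ofReal (ξ * Real.exp (-(ξ * s))) *
        (ENNReal.ofReal (lam / ((1 + lam * s) * (v₁ - v₂))) *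
          ∫⁻ x in Ioo (v₂ * s) (v₁ * s), φ x) := by
  have hm := measurable_coneIntegrand v₁ v₂ ξ lam
  have h1 : ∀ x, coneDensity v₁ v₂ ξ lam t x * φ x =
      ∫⁻ s in Ioo 0 t, ENNReal.ofReal (ξ * Real.exp (-(ξ * s))) * (ENNReal.ofReal
        (lam / ((1 + lam * s) * (v₁ - v₂))) * (Ioo (v₂ * s) (v₁ * s)).indicator 1 x) * φ x :=
    fun x => (lintegral_mul_const _ (hm.comp measurable_prodMk_right)).symm
  simp_rw [h1]
  rw [lintegral_lintegral_swap]
  · refine lintegral_congr fun s => ?_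
    have hi : Measurable ((Ioo (v₂ * s) (v₁ * s)).indicator φ) := hφ.indicator measurableSet_Ioo
    rw [← lintegral_indicator measurableSet_Ioo, ← lintegral_const_mul _ hi,
      ← lintegral_const_mul _ (by fun_prop)]
    refine lintegral_congr fun x => ?_
    by_cases hx : x ∈ Ioo (v₂ * s) (v₁ * s)
    · simp only [indicator_of_mem hx, Pi.one_apply, mul_one, mul_assoc]
    · simp only [indicator_of_notMem hx, mul_zero, zero_mul]
  · have : Measurable fun p : ℝ × ℝ => φ p.1 := hφ.comp measurable_fst
    exact ((hm.comp measurable_swap).mul this).aemeasurable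

theorem lintegral_unperturbedAgeDensity_mul (ξ lam t : ℝ) {v : ℝ} (hv : v ≠ 0) (φ : ℝ → ℝ≥0∞) :
    ∫⁻ x, ENNReal.ofReal |v|⁻¹ * unperturbedAgeDensity ξ lam t (x / v) * φ x =
      ∫⁻ s in Ioo 0 t, ENNReal.ofReal (ξ * Real.exp (-(ξ * s))) *
        (ENNReal.ofReal (1 / (1 + lam * s)) * φ (v * s)) := by
  have h := lintegral_comp_affine (c := v) (d := 0) hv (Ioo 0 t) measurableSet_Ioo
    (fun x => ENNReal.ofReal (ξ * Real.exp (-(ξ * (x / v)))) *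
        (ENNReal.ofReal (1 / (1 + lam * (x / v))) * φ x))
  have himg : (fun u : ℝ => 0 + v * u) '' Ioo 0 t = (fun x => x / v) ⁻¹' Ioo 0 t := by
    ext x
    simp only [mem_image, mem_preimage, zero_add]
    exact ⟨by rintro ⟨u, hu, rfl⟩; rwa [mul_div_cancel_left₀ _ hv],
      fun h => ⟨x / v, h, mul_div_cancel₀ _ hv⟩⟩
  have hmeas : MeasurableSet ((fun x : ℝ => x / v) ⁻¹' Ioo 0 t) :=
    (measurable_id.div_const v) measurableSet_Ioo
  simp only [zero_add, mul_div_cancel_left₀ _ hv] at h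
  simp only [zero_add] at himg
  rw [h, himg, ← lintegral_const_mul' _ _ ENNReal.ofReal_ne_top, ← lintegral_indicator hmeas]
  refine lintegral_congr_ae ?_
  have h0 : ∀ᵐ x : ℝ, x ≠ 0 := by simp [ae_iff]
  filter_upwards [h0] with x hx
  have hx' : x / v ≠ 0 := div_ne_zero hx hv
  rw [unperturbedAgeDensity, if_neg hx']
  by_cases hm : x / v ∈ Ioo 0 t
  · rw [indicator_of_mem hm, indicator_of_mem (by exact hm)]
    ring
  · rw [indicator_of_notMem hm, indicator_of_notMem (by exact hm), mul_zero, zero_mul]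

/-- The only atoms come from motions with neither a reset nor a velocity change up to `t`; they sit
at `v₁ * t` and `v₂ * t`, where `φ` vanishes. The parts that do not depend on the initial velocity
carry total weight `q + (1 - q) = 1`. -/
theorem lintegral_resetLaw_eq {v₁ v₂ q ξ lam t : ℝ} (hv : v₂ < v₁) (hv₁ : v₁ ≠ 0) (hv₂ : v₂ ≠ 0)
    (hξ : 0 < ξ) (hq₀ : 0 ≤ q) (hq₁ : q ≤ 1) (hl : 0 < lam) (ht : 0 ≤ t)
    (φ : ℝ → ℝ≥0∞) (hφ : Measurable φ) (h₁ : φ (v₁ * t) = 0) (h₂ : φ (v₂ * t) = 0) :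
    ∫⁻ x, φ x ∂(resetLaw v₁ v₂ q ξ lam t) = ∫⁻ x, resetDensity v₁ v₂ q ξ lam t x * φ x := by
  have hmc := measurable_coneDensity v₁ v₂ ξ lam t
  have hmu := measurable_unperturbedAgeDensity ξ lam t
  have hmI : Measurable ((Ioo (v₂ * t) (v₁ * t)).indicator (1 : ℝ → ℝ≥0∞)) :=
    measurable_one.indicator measurableSet_Ioo
  have hmC := measurable_setLIntegral_cone v₁ v₂ φ hφ
  have hsplit : ∀ j, ∫⁻ s in Ioo 0 t, ENNReal.ofReal (ξ * Real.exp (-(ξ * s))) *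
      positionIntegral v₁ v₂ lam j φ s =
      (∫⁻ x, ENNReal.ofReal |velocityOf v₁ v₂ j|⁻¹ *
        unperturbedAgeDensity ξ lam t (x / velocityOf v₁ v₂ j) * φ x) +
      ∫⁻ x, coneDensity v₁ v₂ ξ lam t x * φ x := by
    intro j
    have hvj : velocityOf v₁ v₂ j ≠ 0 := by cases j <;> simpa [velocityOf]
    rw [lintegral_unperturbedAgeDensity_mul ξ lam t hvj, lintegral_coneDensity_mul _ _ _ _ _ _ hφ,
      ← lintegral_add_left (by fun_prop)]
    simp only [positionIntegral, mul_add]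
  have hend : ∀ j, positionIntegral v₁ v₂ lam j φ t =
      ENNReal.ofReal (lam / ((1 + lam * t) * (v₁ - v₂))) *
        ∫⁻ x, (Ioo (v₂ * t) (v₁ * t)).indicator 1 x * φ x := by
    intro j
    have hvj : φ (velocityOf v₁ v₂ j * t) = 0 := by cases j <;> simpa [velocityOf]
    rw [positionIntegral, hvj, mul_zero, zero_add, ← lintegral_indicator measurableSet_Ioo]
    congr 2; ext x
    by_cases hx : x ∈ Ioo (v₂ * t) (v₁ * t) <;> simp [hx]
  have hone : ENNReal.ofReal q + ENNReal.ofReal (1 - q) = 1 := by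
    rw [← ENNReal.ofReal_add hq₀ (by linarith), add_sub_cancel, ENNReal.ofReal_one]
  have hexp : ∀ x, resetDensity v₁ v₂ q ξ lam t x * φ x =
      ENNReal.ofReal (Real.exp (-(ξ * t))) * (ENNReal.ofReal (lam / ((1 + lam * t) * (v₁ - v₂))) *
        ((Ioo (v₂ * t) (v₁ * t)).indicator 1 x * φ x)) +
      coneDensity v₁ v₂ ξ lam t x * φ x +
      ENNReal.ofReal q * (ENNReal.ofReal |v₁|⁻¹ * unperturbedAgeDensity ξ lam t (x / v₁) * φ x) +
      ENNReal.ofReal (1 - q) *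
        (ENNReal.ofReal |v₂|⁻¹ * unperturbedAgeDensity ξ lam t (x / v₂) * φ x) := by
    intro x
    rw [resetDensity]
    generalize ENNReal.ofReal (lam / ((1 + lam * t) * (v₁ - v₂))) = c
    ring
  rw [lintegral_resetLaw hv hξ hl ht φ hφ, hsplit true, hsplit false, hend true, hend false]
  simp_rw [hexp]
  rw [lintegral_add_left (by fun_prop), lintegral_add_left (by fun_prop),
    lintegral_add_left (by fun_prop), lintegral_const_mul _ (by fun_prop),
    lintegral_const_mul _ (by fun_prop), lintegral_const_mul _ (by fun_prop),
    lintegral_const_mul _ (by fun_prop)]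
  simp only [velocityOf, if_true, Bool.false_eq_true, if_false]
  generalize ENNReal.ofReal (Real.exp (-(ξ * t))) * (ENNReal.ofReal
    (lam / ((1 + lam * t) * (v₁ - v₂))) * ∫⁻ x, (Ioo (v₂ * t) (v₁ * t)).indicator 1 x * φ x) = a
  generalize (∫⁻ x, coneDensity v₁ v₂ ξ lam t x * φ x) = b
  generalize (∫⁻ x, ENNReal.ofReal |v₁|⁻¹ * unperturbedAgeDensity ξ lam t (x / v₁) * φ x) = c
  generalize (∫⁻ x, ENNReal.ofReal |v₂|⁻¹ * unperturbedAgeDensity ξ lam t (x / v₂) * φ x) = d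
  calc _ = (ENNReal.ofReal q + ENNReal.ofReal (1 - q)) * (a + b) + ENNReal.ofReal q * c +
        ENNReal.ofReal (1 - q) * d := by ring
    _ = _ := by rw [hone, one_mul]

/-! ### Continuity of the density -/

theorem continuousAt_indicator_Ioo {a b x : ℝ} (ha : x ≠ a) (hb : x ≠ b) :
    ContinuousAt ((Ioo a b).indicator (1 : ℝ → ℝ≥0∞)) x := by
  refine continuousOn_const.continuousAt_indicator fun h => ?_
  rcases lt_or_ge a b with hab | hab
  · rw [frontier_Ioo hab] at h
    rcases h with h | h
    · exact ha h
    · exact hb h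
  · rw [Ioo_eq_empty (not_lt.2 hab), frontier_empty] at h
    exact h

/-- At given `x`, the integrand is continuous in the position for every `s` except `x / v₁` and `x /
v₂`, and for fixed `lam` it is bounded by a constant, even at `x = 0`. -/
theorem continuous_coneDensity {v₁ v₂ ξ lam : ℝ} (t : ℝ) (hv : v₂ < v₁) (hv₁ : v₁ ≠ 0)
    (hv₂ : v₂ ≠ 0) (hξ : 0 < ξ) (hl : 0 < lam) : Continuous (coneDensity v₁ v₂ ξ lam t) := by
  have hd : 0 < v₁ - v₂ := sub_pos.2 hv
  refine continuous_iff_continuousAt.2 fun x => ?_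
  refine tendsto_lintegral_filter_of_dominated_convergence
    (fun _ => ENNReal.ofReal ξ * ENNReal.ofReal (lam / (v₁ - v₂))) ?_ ?_ ?_ ?_
  · exact Eventually.of_forall fun y =>
      (measurable_coneIntegrand v₁ v₂ ξ lam).comp measurable_prodMk_right
  · refine Eventually.of_forall fun y => ?_
    filter_upwards [ae_restrict_mem measurableSet_Ioo] with s hs
    have hls : 0 < lam * s := mul_pos hl hs.1
    refine mul_le_mul' (ENNReal.ofReal_le_ofReal ?_) ?_
    · exact mul_le_of_le_one_right hξ.le (Real.exp_le_one_iff.2 (by nlinarith [hs.1]))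
    · refine (mul_le_mul' (ENNReal.ofReal_le_ofReal ?_)
        (indicator_le_self' (fun _ _ => zero_le) y)).trans_eq (mul_one _)
      exact div_le_div_of_nonneg_left hl.le hd (le_mul_of_one_le_left hd.le (by linarith))
  · rw [setLIntegral_const]
    exact ENNReal.mul_ne_top (ENNReal.mul_ne_top ENNReal.ofReal_ne_top ENNReal.ofReal_ne_top)
      (by simp)
  · have h1 : ∀ᵐ s ∂(volume.restrict (Ioo 0 t)), s ≠ x / v₁ := by
      refine ae_restrict_of_ae ?_
      simp [ae_iff]
    have h2 : ∀ᵐ s ∂(volume.restrict (Ioo 0 t)), s ≠ x / v₂ := by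
      refine ae_restrict_of_ae ?_
      simp [ae_iff]
    filter_upwards [h1, h2] with s hs1 hs2
    refine ENNReal.Tendsto.const_mul (ENNReal.Tendsto.const_mul
      (continuousAt_indicator_Ioo ?_ ?_) (Or.inr ENNReal.ofReal_ne_top))
      (Or.inr ENNReal.ofReal_ne_top)
    · rintro rfl; exact hs2 (by field_simp)
    · rintro rfl; exact hs1 (by field_simp)

theorem isAveragedAt_unperturbedAgeDensity {ξ lam t y : ℝ} (hξ : 0 < ξ) (hl : 0 < lam)
    (ht : 0 < t) (hy : y ≠ t) : IsAveragedAt (unperturbedAgeDensity ξ lam t) y := by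
  have hcont : ContinuousOn (fun s => ENNReal.ofReal (ξ * Real.exp (-(ξ * s))) *
      ENNReal.ofReal (1 / (1 + lam * s))) (Icc 0 t) := by
    have h : ∀ s, ENNReal.ofReal (ξ * Real.exp (-(ξ * s))) * ENNReal.ofReal (1 / (1 + lam * s)) =
        ENNReal.ofReal (ξ * Real.exp (-(ξ * s)) * (1 / (1 + lam * s))) := fun s =>
      (ENNReal.ofReal_mul (by positivity)).symm
    simp_rw [h]
    refine ENNReal.continuous_ofReal.comp_continuousOn (ContinuousOn.mul (by fun_prop)
      (continuousOn_const.div (by fun_prop) fun s hs => ?_))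
    have := mul_nonneg hl.le hs.1
    positivity
  rcases eq_or_ne y 0 with rfl | h0
  · refine ⟨0, ENNReal.ofReal ξ, ?_, ?_, ?_⟩
    · refine tendsto_const_nhds.congr' ?_
      filter_upwards [self_mem_nhdsWithin] with y (hy : y < 0)
      rw [unperturbedAgeDensity, if_neg hy.ne, indicator_of_notMem fun h => not_lt.2 hy.le h.1]
    · have h1 := (hcont 0 (left_mem_Icc.2 ht.le)).tendsto
      simp only [mul_zero, neg_zero, Real.exp_zero, mul_one, add_zero, div_one,
        ENNReal.ofReal_one] at h1
      have h2 := h1.mono_left (nhdsWithin_mono _ Ioo_subset_Icc_self)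
      rw [nhdsWithin_Ioo_eq_nhdsGT ht] at h2
      refine h2.congr' ?_
      filter_upwards [Ioo_mem_nhdsGT ht] with y hy
      rw [unperturbedAgeDensity, if_neg hy.1.ne', indicator_of_mem hy]
    · rw [unperturbedAgeDensity, if_pos rfl, zero_add]
  · refine IsAveragedAt.of_continuousAt ?_
    have h1 : ContinuousAt ((Ioo 0 t).indicator fun s =>
        ENNReal.ofReal (ξ * Real.exp (-(ξ * s))) * ENNReal.ofReal (1 / (1 + lam * s))) y := by
      refine ContinuousOn.continuousAt_indicator ?_ ?_
      · exact hcont.mono (interior_subset.trans Ioo_subset_Icc_self)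
      · rw [frontier_Ioo ht]
        rintro (h | h)
        · exact h0 h
        · exact hy h
    refine h1.congr ?_
    filter_upwards [isOpen_ne.mem_nhds h0] with z hz
    rw [unperturbedAgeDensity, if_neg hz]

theorem isDensityOn_resetLaw {v₁ v₂ q ξ lam t : ℝ} (hv : v₂ < v₁) (hv₁ : v₁ ≠ 0) (hv₂ : v₂ ≠ 0)
    (hξ : 0 < ξ) (hq₀ : 0 ≤ q) (hq₁ : q ≤ 1) (hl : 0 < lam) (ht : 0 < t) :
    IsDensityOn (resetLaw v₁ v₂ q ξ lam t) (densityDomain v₁ v₂ t)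
      (resetDensity v₁ v₂ q ξ lam t) := by
  have hn1 : v₁ * t ∉ densityDomain v₁ v₂ t := fun h => lt_irrefl _ h.1.2
  have hn2 : v₂ * t ∉ densityDomain v₁ v₂ t := fun h => h.2 rfl
  refine isDensityOn_of_isAveragedAt (measurable_resetDensity _ _ _ _ _ _)
    (isOpen_Ioo.sdiff isClosed_singleton) (fun x hx => ?_) fun B hB hBU => ?_
  · have hx1 : x ≠ v₁ * t := fun h => hn1 (h ▸ hx)
    have hx2 : x ≠ v₂ * t := fun h => hn2 (h ▸ hx)
    have hatom : ∀ v, v ≠ 0 → x ≠ v * t → IsAveragedAt (fun x =>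
        ENNReal.ofReal |v|⁻¹ * unperturbedAgeDensity ξ lam t (x / v)) x := fun v hv0 hxv =>
      ((isAveragedAt_unperturbedAgeDensity hξ hl ht fun h => hxv (by
        rw [← h, mul_div_cancel₀ _ hv0])).comp_div hv0).const_mul ENNReal.ofReal_ne_top
    exact ((((IsAveragedAt.of_continuousAt (continuousAt_indicator_Ioo hx2 hx1)).const_mul
      ENNReal.ofReal_ne_top).const_mul ENNReal.ofReal_ne_top).add
      (IsAveragedAt.of_continuousAt (continuous_coneDensity t hv hv₁ hv₂ hξ hl).continuousAt)).add
      ((hatom v₁ hv₁ hx1).const_mul ENNReal.ofReal_ne_top) |>.add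
      ((hatom v₂ hv₂ hx2).const_mul ENNReal.ofReal_ne_top)
  · exact lintegral_resetLaw_eq hv hv₁ hv₂ hξ hq₀ hq₁ hl ht.le _ (measurable_one.indicator hB)
      (indicator_of_notMem (fun h => hn1 (hBU h)) _) (indicator_of_notMem (fun h => hn2 (hBU h)) _)

theorem isDensityOn_freeLaw {v₁ v₂ q lam t : ℝ} (hv : v₂ < v₁)
    (hq₀ : 0 ≤ q) (hq₁ : q ≤ 1) (hl : 0 < lam) (ht : 0 < t) :
    IsDensityOn (freeLaw v₁ v₂ q lam t) (Ioo (v₂ * t) (v₁ * t))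
      fun _ => ENNReal.ofReal (lam / ((1 + lam * t) * (v₁ - v₂))) := by
  refine isDensityOn_of_isAveragedAt measurable_const isOpen_Ioo
    (fun x _ => IsAveragedAt.of_continuousAt continuousAt_const) fun B hB hBU => ?_
  have hone : ENNReal.ofReal q + ENNReal.ofReal (1 - q) = 1 := by
    rw [← ENNReal.ofReal_add hq₀ (by linarith), add_sub_cancel, ENNReal.ofReal_one]
  have hpos : ∀ j, positionIntegral v₁ v₂ lam j (B.indicator 1) t =
      ENNReal.ofReal (lam / ((1 + lam * t) * (v₁ - v₂))) * volume B := by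
    intro j
    have hn : velocityOf v₁ v₂ j * t ∉ B := fun h => by
      have := hBU h
      cases j
      · exact lt_irrefl _ this.1
      · exact lt_irrefl _ this.2
    rw [positionIntegral, indicator_of_notMem hn, mul_zero, zero_add, lintegral_indicator_one hB,
      Measure.restrict_apply hB, inter_eq_left.2 hBU]
  rw [lintegral_freeLaw hv hl ht.le _ (measurable_one.indicator hB), hpos true, hpos false,
    ← add_mul, hone, one_mul, lintegral_const_mul _ (measurable_one.indicator hB),
    lintegral_indicator_one hB]

/-! ### Limits of large intensity -/

theorem tendsto_div_one_add_mul {s : ℝ} (hs : 0 < s) (d : ℝ) :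
    Tendsto (fun lam : ℝ => lam / ((1 + lam * s) * d)) atTop (𝓝 (1 / (s * d))) := by
  have h1 : Tendsto (fun lam : ℝ => 1 / ((lam⁻¹ + s) * d)) atTop (𝓝 (1 / (s * d))) := by
    have h2 : Tendsto (fun lam : ℝ => (lam⁻¹ + s)⁻¹ * d⁻¹) atTop (𝓝 ((0 + s)⁻¹ * d⁻¹)) :=
      ((tendsto_inv_atTop_zero.add_const s).inv₀ (by simpa using hs.ne')).mul_const _
    simpa [mul_inv, mul_comm] using h2
  refine h1.congr' ?_
  filter_upwards [eventually_gt_atTop 0] with lam hl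
  have : 0 < lam * s := by positivity
  rcases eq_or_ne d 0 with rfl | hd
  · simp
  · field_simp

theorem tendsto_uniform_part {v₁ v₂ t : ℝ} (ht : 0 < t) :
    Tendsto (fun lam : ℝ => ENNReal.ofReal (lam / ((1 + lam * t) * (v₁ - v₂)))) atTop
      (𝓝 (ENNReal.ofReal (1 / ((v₁ - v₂) * t)))) := by
  rw [mul_comm (v₁ - v₂)]
  exact ENNReal.tendsto_ofReal (tendsto_div_one_add_mul ht _)

theorem div_one_add_mul_le {a b s d : ℝ} (ha : 0 ≤ a) (hab : a ≤ b) (hs : 0 ≤ s) (hd : 0 < d) :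
    a / ((1 + a * s) * d) ≤ b / ((1 + b * s) * d) := by
  have h1 : 0 ≤ a * s := mul_nonneg ha hs
  have h2 : 0 ≤ b * s := mul_nonneg (ha.trans hab) hs
  rw [div_le_div_iff₀ (by positivity) (by positivity)]
  nlinarith [mul_le_mul_of_nonneg_right hab hd.le]

theorem monotone_coneDensity {v₁ v₂ : ℝ} (ξ t x : ℝ) (hv : v₂ < v₁) :
    Monotone fun lam => coneDensity v₁ v₂ ξ (max lam 0) t x := by
  have hd : 0 < v₁ - v₂ := sub_pos.2 hv
  intro a b hab
  refine setLIntegral_mono' measurableSet_Ioo fun s hs => ?_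
  refine mul_le_mul_right (mul_le_mul_left (ENNReal.ofReal_le_ofReal ?_) _) _
  exact div_one_add_mul_le (le_max_right _ _) (max_le_max_right 0 hab) hs.1.le hd

theorem tendsto_coneDensity {v₁ v₂ : ℝ} (ξ t x : ℝ) (hv : v₂ < v₁) :
    Tendsto (fun lam => coneDensity v₁ v₂ ξ lam t x) atTop
      (𝓝 (∫⁻ s in Ioo 0 t, ENNReal.ofReal (ξ * Real.exp (-(ξ * s))) *
        (ENNReal.ofReal (1 / (s * (v₁ - v₂))) * (Ioo (v₂ * s) (v₁ * s)).indicator 1 x))) := by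
  have hd : 0 < v₁ - v₂ := sub_pos.2 hv
  -- The limit may be infinite, so monotone rather than dominated convergence is used. It is
  -- available along the integers; monotonicity in real `lam`, extended to negative values through
  -- `max lam 0`, transfers the limit.
  have hsup := tendsto_atTop_iSup (monotone_coneDensity ξ t x hv)
  have hnat : Tendsto (fun n : ℕ => coneDensity v₁ v₂ ξ (max (n : ℝ) 0) t x) atTop
      (𝓝 (∫⁻ s in Ioo 0 t, ENNReal.ofReal (ξ * Real.exp (-(ξ * s))) *
        (ENNReal.ofReal (1 / (s * (v₁ - v₂))) * (Ioo (v₂ * s) (v₁ * s)).indicator 1 x))) := by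
    refine lintegral_tendsto_of_tendsto_of_monotone (fun n => ?_) ?_ ?_
    · exact ((measurable_coneIntegrand v₁ v₂ ξ _).comp measurable_prodMk_right).aemeasurable
    · filter_upwards [ae_restrict_mem measurableSet_Ioo] with s hs n m hnm
      refine mul_le_mul_right (mul_le_mul_left (ENNReal.ofReal_le_ofReal ?_) _) _
      exact div_one_add_mul_le (le_max_right _ _) (max_le_max_right 0 (Nat.cast_le.2 hnm)) hs.1.le hd
    · filter_upwards [ae_restrict_mem measurableSet_Ioo] with s hs
      refine ENNReal.Tendsto.const_mul (ENNReal.Tendsto.mul_const ?_ (Or.inr ?_))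
        (Or.inr ENNReal.ofReal_ne_top)
      · have h3 := (ENNReal.tendsto_ofReal (tendsto_div_one_add_mul hs.1 (v₁ - v₂))).comp
          (tendsto_natCast_atTop_atTop (R := ℝ))
        refine h3.congr fun n => ?_
        simp
      · exact ((indicator_le_self' (fun _ _ => zero_le) x).trans_lt ENNReal.one_lt_top).ne
  rw [tendsto_nhds_unique (hsup.comp (tendsto_natCast_atTop_atTop (R := ℝ))) hnat] at hsup
  refine hsup.congr' ?_
  filter_upwards [eventually_ge_atTop 0] with lam hl
  rw [max_eq_left hl]

theorem tendsto_unperturbedAgeDensity {ξ t y : ℝ} (hy : y ≠ 0) :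
    Tendsto (fun lam => unperturbedAgeDensity ξ lam t y) atTop (𝓝 0) := by
  simp only [unperturbedAgeDensity, if_neg hy]
  by_cases h : y ∈ Ioo 0 t
  · simp only [indicator_of_mem h]
    have h1 : Tendsto (fun lam : ℝ => 1 / (1 + lam * y)) atTop (𝓝 0) :=
      tendsto_const_nhds.div_atTop (tendsto_atTop_add_const_left _ _
        (tendsto_id.atTop_mul_const h.1))
    have h2 := ENNReal.Tendsto.const_mul (a := ENNReal.ofReal (ξ * Real.exp (-(ξ * y))))
      (ENNReal.tendsto_ofReal h1) (Or.inr ENNReal.ofReal_ne_top)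
    simpa using h2
  · simp only [indicator_of_notMem h, tendsto_const_nhds]

/-! ### The limiting density -/

theorem genIncGamma_zero {ξ : ℝ} (hξ : 0 < ξ) (a b : ℝ) :
    genIncGamma 0 (a * ξ) (b * ξ) =
      ∫⁻ s in Ioo a b, ENNReal.ofReal (Real.exp (-(ξ * s)) / s) := by
  have h := lintegral_comp_affine (c := ξ) (d := 0) hξ.ne' (Ioo a b) measurableSet_Ioo
    (fun u => ENNReal.ofReal (u ^ ((0 : ℝ) - 1) * Real.exp (-u)))
  have himg : (fun u : ℝ => 0 + ξ * u) '' Ioo a b = Ioo (a * ξ) (b * ξ) := by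
    simp only [zero_add]
    rw [image_mul_left_Ioo hξ, mul_comm ξ, mul_comm ξ]
  rw [himg] at h
  rw [genIncGamma, ← ENNReal.mul_right_inj (a := ENNReal.ofReal |ξ|⁻¹) (by simpa using hξ.ne')
    ENNReal.ofReal_ne_top, ← h, ← lintegral_const_mul' _ _ ENNReal.ofReal_ne_top]
  refine lintegral_congr fun s => ?_
  rw [zero_sub, Real.rpow_neg_one, ← ENNReal.ofReal_mul (by positivity), abs_of_pos hξ, zero_add]
  congr 1
  rw [mul_inv]; ring

/-- The times since the last reset at which `x` can be reached form an interval. -/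
theorem exists_reachable_Ioo {v₁ v₂ t x : ℝ} (hv₁ : 0 < v₁) (hv₂ : v₂ ≠ 0)
    (ht : 0 < t) (hx : x ∈ densityDomain v₁ v₂ t) :
    ∃ a b, 0 ≤ a ∧ (x ≠ 0 → 0 < a) ∧
      (∀ ξ, limitGamma v₁ v₂ ξ t x = genIncGamma 0 (a * ξ) (b * ξ)) ∧
      ∀ s, s ∈ Ioo a b ↔ s ∈ Ioo 0 t ∧ x ∈ Ioo (v₂ * s) (v₁ * s) := by
  rcases lt_or_gt_of_ne hv₂ with h2 | h2
  · have hpos : x ≠ 0 → 0 < max (x / v₁) (x / v₂) := fun h0 => by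
      rcases lt_or_gt_of_ne h0 with h | h
      · exact lt_max_of_lt_right (div_pos_of_neg_of_neg h h2)
      · exact lt_max_of_lt_left (div_pos h hv₁)
    have hnn : 0 ≤ max (x / v₁) (x / v₂) := by
      rcases eq_or_ne x 0 with rfl | h0
      · simp
      · exact (hpos h0).le
    refine ⟨max (x / v₁) (x / v₂), t, hnn, hpos, fun ξ => by rw [limitGamma, if_pos h2],
      fun s => ?_⟩
    simp only [mem_Ioo, max_lt_iff, div_lt_iff₀ hv₁, div_lt_iff_of_neg h2]
    constructor
    · rintro ⟨⟨h3, h4⟩, h5⟩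
      refine ⟨⟨lt_of_le_of_lt hnn ?_, h5⟩, by linarith, by linarith⟩
      rw [max_lt_iff, div_lt_iff₀ hv₁, div_lt_iff_of_neg h2]
      exact ⟨h3, h4⟩
    · rintro ⟨⟨_, h5⟩, h3, h4⟩
      exact ⟨⟨by linarith, by linarith⟩, h5⟩
  · have hx0 : 0 < x := by
      have h := hx.1.1
      rwa [min_eq_right (mul_nonneg h2.le ht.le)] at h
    have hpos : 0 < x / v₁ := div_pos hx0 hv₁
    refine ⟨x / v₁, min (x / v₂) t, hpos.le, fun _ => hpos,
      fun ξ => by rw [limitGamma, if_neg h2.not_gt], fun s => ?_⟩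
    simp only [mem_Ioo, lt_min_iff, div_lt_iff₀ hv₁, lt_div_iff₀ h2]
    constructor
    · rintro ⟨h3, h4, h5⟩
      exact ⟨⟨by nlinarith, h5⟩, by linarith, by linarith⟩
    · rintro ⟨⟨_, h5⟩, h3, h4⟩
      exact ⟨by linarith, by linarith, h5⟩

theorem coneLimit_eq {v₁ v₂ ξ t x : ℝ} (hv : v₂ < v₁) (hv₁ : 0 < v₁) (hv₂ : v₂ ≠ 0)
    (hξ : 0 < ξ) (ht : 0 < t) (hx : x ∈ densityDomain v₁ v₂ t) :
    ∫⁻ s in Ioo 0 t, ENNReal.ofReal (ξ * Real.exp (-(ξ * s))) *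
        (ENNReal.ofReal (1 / (s * (v₁ - v₂))) * (Ioo (v₂ * s) (v₁ * s)).indicator 1 x) =
      ENNReal.ofReal (ξ / (v₁ - v₂)) * limitGamma v₁ v₂ ξ t x := by
  obtain ⟨a, b, -, -, hG, hset⟩ := exists_reachable_Ioo hv₁ hv₂ ht hx
  have hd : 0 < v₁ - v₂ := sub_pos.2 hv
  rw [hG ξ, genIncGamma_zero hξ, ← lintegral_const_mul' _ _ ENNReal.ofReal_ne_top,
    ← lintegral_indicator measurableSet_Ioo, ← lintegral_indicator measurableSet_Ioo]
  refine lintegral_congr fun s => ?_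
  by_cases hs : s ∈ Ioo a b
  · obtain ⟨h1, h2⟩ := (hset s).1 hs
    rw [indicator_of_mem hs, indicator_of_mem h1, indicator_of_mem h2, Pi.one_apply, mul_one,
      ← ENNReal.ofReal_mul (by positivity), ← ENNReal.ofReal_mul (by positivity)]
    congr 1
    have := h1.1
    field_simp
  · rw [indicator_of_notMem hs]
    by_cases h1 : s ∈ Ioo 0 t
    · rw [indicator_of_mem h1, indicator_of_notMem fun h => hs ((hset s).2 ⟨h1, h⟩), mul_zero,
        mul_zero]
    · rw [indicator_of_notMem h1]

/-- On `(0, t)` the integrand is at least `exp (-(ξ * t)) / s`, and `1 / s` is not integrable at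
`0`. -/
theorem limitGamma_zero {v₁ v₂ ξ t : ℝ} (hv₂ : v₂ < 0) (hξ : 0 < ξ) (ht : 0 < t) :
    limitGamma v₁ v₂ ξ t 0 = ∞ := by
  rw [limitGamma, if_pos hv₂, zero_div, zero_div, max_self, genIncGamma_zero hξ]
  have h1 : ¬ IntegrableOn (fun s : ℝ => s⁻¹) (Ioo 0 t) := by
    intro h
    have h2 : IntervalIntegrable (fun s : ℝ => s⁻¹) volume 0 t :=
      (intervalIntegrable_iff_integrableOn_Ioo_of_le ht.le).2 h
    rw [intervalIntegrable_inv_iff] at h2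
    rcases h2 with h2 | h2
    · exact ht.ne h2
    · exact h2 left_mem_uIcc
  have h3 : ∫⁻ s in Ioo 0 t, ENNReal.ofReal s⁻¹ = ∞ := by
    by_contra hne
    refine h1 ⟨measurable_inv.aestronglyMeasurable, ?_⟩
    rw [hasFiniteIntegral_iff_ofReal]
    · exact lt_top_iff_ne_top.2 hne
    · filter_upwards [ae_restrict_mem measurableSet_Ioo] with s hs using inv_nonneg.2 hs.1.le
  have h4 : ENNReal.ofReal (Real.exp (-(ξ * t))) * ∫⁻ s in Ioo 0 t, ENNReal.ofReal s⁻¹ ≤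
      ∫⁻ s in Ioo 0 t, ENNReal.ofReal (Real.exp (-(ξ * s)) / s) := by
    rw [← lintegral_const_mul _ (by fun_prop)]
    refine setLIntegral_mono' measurableSet_Ioo fun s hs => ?_
    rw [← ENNReal.ofReal_mul (by positivity), div_eq_mul_inv]
    refine ENNReal.ofReal_le_ofReal (mul_le_mul_of_nonneg_right (Real.exp_le_exp.2 ?_)
      (inv_nonneg.2 hs.1.le))
    nlinarith [hs.2]
  rw [h3, ENNReal.mul_top (by simpa using Real.exp_pos _)] at h4
  exact top_le_iff.1 h4

theorem tendsto_resetDensity {v₁ v₂ ξ t x : ℝ} (q : ℝ) (hv : v₂ < v₁) (hv₁ : 0 < v₁)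
    (hv₂ : v₂ ≠ 0) (hξ : 0 < ξ) (ht : 0 < t) (hx : x ∈ densityDomain v₁ v₂ t) :
    Tendsto (fun lam => resetDensity v₁ v₂ q ξ lam t x) atTop (𝓝 (limitDensity v₁ v₂ ξ t x)) := by
  have hd : 0 < v₁ - v₂ := sub_pos.2 hv
  have hI : (Ioo (v₂ * t) (v₁ * t)).indicator (1 : ℝ → ℝ≥0∞) x ≠ ∞ :=
    ((indicator_le_self' (fun _ _ => zero_le) x).trans_lt ENNReal.one_lt_top).ne
  have h1 := ENNReal.Tendsto.const_mul (a := ENNReal.ofReal (Real.exp (-(ξ * t))))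
    (ENNReal.Tendsto.mul_const (tendsto_uniform_part (v₁ := v₁) (v₂ := v₂) ht) (Or.inr hI))
    (Or.inr ENNReal.ofReal_ne_top)
  have h2 := tendsto_coneDensity ξ t x hv
  rw [coneLimit_eq hv hv₁ hv₂ hξ ht hx] at h2
  have hlim : limitDensity v₁ v₂ ξ t x = ENNReal.ofReal (Real.exp (-(ξ * t))) *
      (ENNReal.ofReal (1 / ((v₁ - v₂) * t)) * (Ioo (v₂ * t) (v₁ * t)).indicator 1 x) +
      ENNReal.ofReal (ξ / (v₁ - v₂)) * limitGamma v₁ v₂ ξ t x := by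
    rw [limitDensity, indicator_of_mem hx.1]
    congr 1
    by_cases h : x ∈ Ioo (v₂ * t) (v₁ * t)
    · rw [indicator_of_mem h, indicator_of_mem h, Pi.one_apply, mul_one,
        ← ENNReal.ofReal_mul (by positivity), neg_mul, mul_one_div]
    · rw [indicator_of_notMem h, indicator_of_notMem h, mul_zero, mul_zero]
  rw [hlim]
  have hatom : ∀ v, v ≠ 0 → x ≠ 0 → ∀ c, Tendsto (fun lam => ENNReal.ofReal c *
      (ENNReal.ofReal |v|⁻¹ * unperturbedAgeDensity ξ lam t (x / v))) atTop (𝓝 0) := by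
    intro v hv0 hx0 c
    have := ENNReal.Tendsto.const_mul (a := ENNReal.ofReal c) (ENNReal.Tendsto.const_mul
      (a := ENNReal.ofReal |v|⁻¹)
      (tendsto_unperturbedAgeDensity (ξ := ξ) (t := t) (div_ne_zero hx0 hv0))
      (Or.inr ENNReal.ofReal_ne_top)) (Or.inr ENNReal.ofReal_ne_top)
    simpa using this
  -- At `x = 0` the smeared atoms stay at `ξ / 2` for every `lam` and do not vanish, but
  -- `coneDensity` alone already tends to infinity.
  rcases eq_or_ne x 0 with rfl | hx0
  · have hneg : v₂ < 0 := by
      rcases lt_or_gt_of_ne hv₂ with h | h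
      · exact h
      · exact absurd hx.1.1 (by rw [min_eq_right (mul_nonneg h.le ht.le)]; exact lt_irrefl _)
    have hpos : 0 < ξ / (v₁ - v₂) := div_pos hξ hd
    rw [limitGamma_zero hneg hξ ht, ENNReal.mul_top (by simpa using hpos)] at h2 ⊢
    rw [add_top]
    refine tendsto_nhds_top_mono h2 (Eventually.of_forall fun lam => ?_)
    exact le_add_right (le_add_right le_add_self)
  · have := ((h1.add h2).add (hatom v₁ hv₁.ne' hx0 q)).add (hatom v₂ hv₂ hx0 (1 - q))
    rwa [add_zero, add_zero] at this

/-! ### Vanishing reset rate -/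

theorem lintegral_exp_div_le {ξ a b : ℝ} (hξ : 0 < ξ) (ha : 0 < a) :
    ∫⁻ s in Ioo a b, ENNReal.ofReal (Real.exp (-(ξ * s)) / s) ≤
      ENNReal.ofReal a⁻¹ * ENNReal.ofReal (b - a) := by
  rw [← Real.volume_Ioo, ← setLIntegral_const]
  refine setLIntegral_mono' measurableSet_Ioo fun s hs => ENNReal.ofReal_le_ofReal ?_
  have hs0 : 0 < s := ha.trans hs.1
  rw [div_eq_mul_inv]
  exact (mul_le_of_le_one_left (inv_nonneg.2 hs0.le)
    (Real.exp_le_one_iff.2 (by nlinarith))).trans (inv_anti₀ ha hs.1.le)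

/-- For `x ≠ 0` the reachable ages stay above some `a > 0`, so the Gamma integral is bounded
uniformly in the reset rate and its prefactor sends it to `0`. -/
theorem tendsto_limitDensity_zero {v₁ v₂ t x : ℝ} (hv₁ : 0 < v₁)
    (hv₂ : v₂ ≠ 0) (ht : 0 < t) (hx : x ∈ densityDomain v₁ v₂ t) (hx0 : x ≠ 0) :
    Tendsto (fun r => limitDensity v₁ v₂ r t x) (𝓝[>] 0) (𝓝 (uniformDensity v₁ v₂ t x)) := by
  obtain ⟨a, b, -, ha, hG, -⟩ := exists_reachable_Ioo hv₁ hv₂ ht hx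
  have h1 : Tendsto (fun r => (Ioo (v₂ * t) (v₁ * t)).indicator
      (fun _ => ENNReal.ofReal (Real.exp (-r * t) / ((v₁ - v₂) * t))) x) (𝓝[>] 0)
      (𝓝 (uniformDensity v₁ v₂ t x)) := by
    rw [uniformDensity]
    by_cases h : x ∈ Ioo (v₂ * t) (v₁ * t)
    · simp only [indicator_of_mem h]
      have h2 : Continuous fun r : ℝ => Real.exp (-r * t) / ((v₁ - v₂) * t) := by fun_prop
      have h3 := (h2.tendsto 0).mono_left (nhdsWithin_le_nhds (s := Ioi 0))
      rw [neg_zero, zero_mul, Real.exp_zero] at h3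
      exact ENNReal.tendsto_ofReal h3
    · simp only [indicator_of_notMem h, tendsto_const_nhds]
  have h2 : Tendsto (fun r => ENNReal.ofReal (r / (v₁ - v₂)) *
      (ENNReal.ofReal a⁻¹ * ENNReal.ofReal (b - a))) (𝓝[>] 0) (𝓝 0) := by
    have h3 : Continuous fun r : ℝ => r / (v₁ - v₂) := by fun_prop
    have h4 := ENNReal.tendsto_ofReal ((h3.tendsto 0).mono_left (nhdsWithin_le_nhds (s := Ioi 0)))
    have h5 := ENNReal.Tendsto.mul_const (b := ENNReal.ofReal a⁻¹ * ENNReal.ofReal (b - a)) h4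
      (Or.inr (ENNReal.mul_ne_top ENNReal.ofReal_ne_top ENNReal.ofReal_ne_top))
    simpa using h5
  have h3 : Tendsto (fun r => ENNReal.ofReal (r / (v₁ - v₂)) *
      (Ioo (min (v₂ * t) 0) (v₁ * t)).indicator (limitGamma v₁ v₂ r t) x) (𝓝[>] 0) (𝓝 0) := by
    refine tendsto_of_tendsto_of_tendsto_of_le_of_le' tendsto_const_nhds h2
      (Eventually.of_forall fun _ => zero_le) ?_
    filter_upwards [self_mem_nhdsWithin] with r (hr : 0 < r)
    rw [indicator_of_mem hx.1, hG r, genIncGamma_zero hr]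
    exact mul_le_mul_right (lintegral_exp_div_le hr (ha hx0)) _
  have h4 := h1.add h3
  rw [add_zero] at h4
  exact h4

/-! ### Non-uniformity of the limit -/

theorem limitDensity_of_pos {v₁ v₂ ξ t x : ℝ} (hv₁ : 0 < v₁) (hv₂ : v₂ ≠ 0) (hξ : 0 < ξ)
    (hx : x ∈ Ioo (max (v₂ * t) 0) (v₁ * t)) :
    limitDensity v₁ v₂ ξ t x = ENNReal.ofReal (Real.exp (-ξ * t) / ((v₁ - v₂) * t)) +
      ENNReal.ofReal (ξ / (v₁ - v₂)) *
        ∫⁻ s in Ioo (x / v₁) t, ENNReal.ofReal (Real.exp (-(ξ * s)) / s) := by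
  obtain ⟨h1, h2⟩ := max_lt_iff.1 hx.1
  have hm1 : x ∈ Ioo (v₂ * t) (v₁ * t) := ⟨h1, hx.2⟩
  have hm2 : x ∈ Ioo (min (v₂ * t) 0) (v₁ * t) := ⟨(min_le_right _ _).trans_lt h2, hx.2⟩
  rw [limitDensity, indicator_of_mem hm1, indicator_of_mem hm2, ← genIncGamma_zero hξ, limitGamma]
  rcases lt_or_gt_of_ne hv₂ with h | h
  · rw [if_pos h, max_eq_left]
    exact (div_nonpos_of_nonneg_of_nonpos h2.le h.le).trans (div_pos h2 hv₁).le
  · rw [if_neg h.not_gt, min_eq_right]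
    rw [le_div_iff₀ h]; linarith

/-- To the right of `v₂ * t` and `0`, the density is a constant plus a positive multiple of the
integral of `exp (-(ξ * s)) / s` over `(x / v₁, t)`, which strictly decreases in `x`. An almost
everywhere constant value would be taken at two points `x < y` on either side of `m`, forcing the
integral over `(x / v₁, y / v₁]` to vanish. -/
theorem not_ae_const_limitDensity {v₁ v₂ ξ t : ℝ} (hv : v₂ < v₁) (hv₁ : 0 < v₁) (hv₂ : v₂ ≠ 0)
    (hξ : 0 < ξ) (ht : 0 < t) :
    ¬ ∃ c : ℝ≥0∞, ∀ᵐ x ∂(volume.restrict (Ioo (v₂ * t) (v₁ * t))),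
      limitDensity v₁ v₂ ξ t x = c := by
  rintro ⟨c, hc⟩
  have hd : 0 < v₁ - v₂ := sub_pos.2 hv
  have hex : ∀ l u, max (v₂ * t) 0 ≤ l → l < u → u ≤ v₁ * t →
      ∃ x ∈ Ioo l u, limitDensity v₁ v₂ ξ t x = c := by
    intro l u hl hlu hu
    have hsub : Ioo l u ⊆ Ioo (v₂ * t) (v₁ * t) := Ioo_subset_Ioo ((le_max_left _ _).trans hl) hu
    have h1 := (ae_restrict_iff' measurableSet_Ioo).1 (ae_restrict_of_ae_restrict_of_subset hsub hc)
    by_contra hcon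
    push Not at hcon
    have h2 : volume (Ioo l u) = 0 :=
      measure_mono_null (fun x hx => show ¬ (x ∈ Ioo l u → limitDensity v₁ v₂ ξ t x = c) from
        fun h => hcon x hx (h hx)) (ae_iff.1 h1)
    rw [Real.volume_Ioo, ENNReal.ofReal_eq_zero] at h2
    linarith
  have hlt : max (v₂ * t) 0 < v₁ * t := max_lt (by nlinarith) (by positivity)
  obtain ⟨m, hm1, hm2⟩ := exists_between hlt
  obtain ⟨x, hx, hxc⟩ := hex _ m le_rfl hm1 hm2.le
  obtain ⟨y, hy, hyc⟩ := hex m _ hm1.le hm2 le_rfl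
  have hx0 : 0 < x := (le_max_right _ _).trans_lt hx.1
  have hxy : x < y := hx.2.trans hy.1
  rw [limitDensity_of_pos hv₁ hv₂ hξ ⟨hx.1, hx.2.trans hm2⟩] at hxc
  rw [limitDensity_of_pos hv₁ hv₂ hξ ⟨hm1.trans hy.1, hy.2⟩, ← hxc] at hyc
  have hpos : 0 < ξ / (v₁ - v₂) := div_pos hξ hd
  rw [ENNReal.add_right_inj ENNReal.ofReal_ne_top,
    ENNReal.mul_right_inj (by simpa using hpos) ENNReal.ofReal_ne_top] at hyc
  have hxv : 0 < x / v₁ := div_pos hx0 hv₁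
  have hxyv : x / v₁ < y / v₁ := div_lt_div_of_pos_right hxy hv₁
  have hyt : y / v₁ < t := by rw [div_lt_iff₀ hv₁]; linarith [hy.2]
  -- Finiteness is what permits cancelling the common part of the two integrals in `ℝ≥0∞`.
  have hfin : ∫⁻ s in Ioo (y / v₁) t, ENNReal.ofReal (Real.exp (-(ξ * s)) / s) ≠ ∞ :=
    ((lintegral_exp_div_le hξ (hxv.trans hxyv)).trans_lt
      (ENNReal.mul_lt_top ENNReal.ofReal_lt_top ENNReal.ofReal_lt_top)).ne
  have hsplit : ∫⁻ s in Ioo (x / v₁) t, ENNReal.ofReal (Real.exp (-(ξ * s)) / s) =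
      (∫⁻ s in Ioc (x / v₁) (y / v₁), ENNReal.ofReal (Real.exp (-(ξ * s)) / s)) +
      ∫⁻ s in Ioo (y / v₁) t, ENNReal.ofReal (Real.exp (-(ξ * s)) / s) := by
    rw [← Ioc_union_Ioo_eq_Ioo hxyv.le hyt, lintegral_union measurableSet_Ioo
      (disjoint_left.2 fun z hz hz' => not_lt.2 hz.2 hz'.1)]
  rw [hsplit] at hyc
  have hzero : ∫⁻ s in Ioc (x / v₁) (y / v₁), ENNReal.ofReal (Real.exp (-(ξ * s)) / s) = 0 :=
    (ENNReal.add_left_inj hfin).1 (by rw [zero_add]; exact hyc.symm)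
  rw [setLIntegral_eq_zero_iff measurableSet_Ioc (by fun_prop)] at hzero
  have h2 : volume (Ioc (x / v₁) (y / v₁)) = 0 := measure_mono_null (fun s hs => by
    have hs0 : 0 < s := hxv.trans hs.1
    have : 0 < Real.exp (-(ξ * s)) / s := by positivity
    simpa [hs.1, hs.2] using this) (ae_iff.1 hzero)
  rw [Real.volume_Ioc, ENNReal.ofReal_eq_zero] at h2
  linarith

end GCPTelegraph

theorem mainTheorem11 (v₁ v₂ ξ q t : ℝ) (hv : v₂ < v₁) (hv₁ : 0 < v₁) (hv₂ : v₂ ≠ 0)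
    (hξ : 0 < ξ) (hq₀ : 0 ≤ q) (hq₁ : q ≤ 1) (ht : 0 < t) :
    -- convergence of the density of the process with resets
    (∃ p : ℝ → ℝ → ℝ≥0∞,
      (∀ lam : ℝ, 0 < lam →
        GCPTelegraph.IsDensityOn (GCPTelegraph.resetLaw v₁ v₂ q ξ lam t)
          (GCPTelegraph.densityDomain v₁ v₂ t) (p lam)) ∧
      ∀ x ∈ GCPTelegraph.densityDomain v₁ v₂ t,
        Tendsto (fun lam => p lam x) atTop (𝓝 (GCPTelegraph.limitDensity v₁ v₂ ξ t x))) ∧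
    -- the limit is not uniform
    (¬ ∃ c : ℝ≥0∞, ∀ᵐ x ∂(volume.restrict (Ioo (v₂ * t) (v₁ * t))),
        GCPTelegraph.limitDensity v₁ v₂ ξ t x = c) ∧
    -- without resets the limit is uniform
    (∃ p : ℝ → ℝ → ℝ≥0∞,
      (∀ lam : ℝ, 0 < lam →
        GCPTelegraph.IsDensityOn (GCPTelegraph.freeLaw v₁ v₂ q lam t)
          (Ioo (v₂ * t) (v₁ * t)) (p lam)) ∧
      ∀ x ∈ Ioo (v₂ * t) (v₁ * t),
        Tendsto (fun lam => p lam x) atTop (𝓝 (GCPTelegraph.uniformDensity v₁ v₂ t x))) ∧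
    -- the limit becomes uniform as the reset rate vanishes
    (∀ x ∈ GCPTelegraph.densityDomain v₁ v₂ t, x ≠ 0 →
      Tendsto (fun r => GCPTelegraph.limitDensity v₁ v₂ r t x) (𝓝[>] 0)
        (𝓝 (GCPTelegraph.uniformDensity v₁ v₂ t x))) := by
  open GCPTelegraph in
  refine ⟨⟨fun lam => resetDensity v₁ v₂ q ξ lam t,
    fun lam hl => isDensityOn_resetLaw hv hv₁.ne' hv₂ hξ hq₀ hq₁ hl ht,
    fun x hx => tendsto_resetDensity q hv hv₁ hv₂ hξ ht hx⟩,
    not_ae_const_limitDensity hv hv₁ hv₂ hξ ht,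
    ⟨fun lam _ => ENNReal.ofReal (lam / ((1 + lam * t) * (v₁ - v₂))),
    fun lam hl => isDensityOn_freeLaw hv hq₀ hq₁ hl ht, fun x hx => ?_⟩,
    fun x hx hx0 => tendsto_limitDensity_zero hv₁ hv₂ ht hx hx0⟩
  rw [GCPTelegraph.uniformDensity, indicator_of_mem hx]
  exact GCPTelegraph.tendsto_uniform_part ht
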